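/- Let $0<q<r$ and $T>0$, and put $\Omega=(-1,1)$, $\alpha=(r-q-1)/2$, $\beta=\alpha^2+r$ and $\varphi(x)=e^{\alpha x}\max(e^x-1,0)$. Let $$\mathcal K=\{v\in H^1(\Omega)\;:\;v-\varphi\in H^1_0(\Omega),\ v\ge\varphi\ \text{a.e. in }\Omega\}.$$ For a time step $h>0$, the discrete Morse semiflow (DMS) is the sequence $u_0,\dots,u_{[T/h]}$ such that $u_0=\varphi$ and, for $m=1,\dots,[T/h]$, $u_m\in\mathcal K$ minimizes over $\mathcal K$ the functional $$J_m(u)=\frac12\int_\Omega\Big\{\frac{|u-u_{m-1}|^2}{h}+(u_x)^2+\beta u^2\Big\}\,dx .$$ Here $[\,\cdot\,]$ is the integer part, and functions in $H^1(\Omega)$ are identified with their continuous representatives on $\overline\Omega=[-1,1]$. Then the DMS exists for every $h>0$, and the following hold. (1) For all $h>0$ and $m=1,\dots,[T/h]$, $u_m$ is the unique solution of the elliptic variational inequality $$\min\Big\{\frac{u_m-u_{m-1}}{h}-u_{m,xx}+\beta u_m,\;u_m-\varphi\Big\}=0\ \text{ in }\Omega,\qquad u_m(\pm1)=\varphi(\pm1),$$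 for the given $u_{m-1}$, both in the a.e. sense (among functions in $H^2(\Omega)$ that satisfy it almost everywhere in $\Omega$, $u_{m,xx}$ being the weak second derivative, and take the boundary values) and in the viscosity sense (among functions in $C(\overline\Omega)$ that are both viscosity subsolutions and viscosity supersolutions in $\Omega$ and take the boundary values). (2) There is a constant $C$, depending only on $q$, $r$ and $T$, such that for all $h>0$ $$h\sum_{m=1}^{[T/h]}\Big\|\frac{u_m-u_{m-1}}{h}\Big\|_{L^2(\Omega)}^2+\sup_{0\le m\le[T/h]}\|u_m\|_{H^1(\Omega)}+h\sum_{m=1}^{[T/h]}\|u_{m,xx}\|_{L^2(\Omega)}^2\le C .$$ -/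

import Mathlib

open MeasureTheory Set
open scoped Distributions ContDiff

noncomputable section

namespace DMSBS

/-- The interval `Ω = (-1, 1)`, as an open subset of the line. -/
def Omega : TopologicalSpace.Opens ℝ := ⟨Ioo (-1) 1, isOpen_Ioo⟩

/-- Lebesgue measure on `Ω`. -/
def leb : Measure ℝ := volume.restrict (Omega : Set ℝ)

/-! ### Sobolev spaces on `Ω` -/

/-- `g` is a weak derivative of `f` on `Ω`. -/
def IsWeakDeriv (f g : ℝ → ℝ) : Prop :=
  LocallyIntegrableOn f (Omega : Set ℝ) ∧ LocallyIntegrableOn g (Omega : Set ℝ) ∧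
    ∀ η : 𝓓(Omega, ℝ), ∫ x, f x * deriv (η : ℝ → ℝ) x ∂leb = -∫ x, g x * η x ∂leb

/-- `v ∈ H¹(Ω)`: `v` and its weak derivative are square integrable on `Ω`. -/
def MemH1 (v : ℝ → ℝ) : Prop :=
  MemLp v 2 leb ∧ ∃ g, MemLp g 2 leb ∧ IsWeakDeriv v g

open Classical in
/-- The weak derivative `v_x` of `v ∈ H¹(Ω)` (determined almost everywhere in `Ω`); it is `0` by
convention outside `H¹(Ω)`. -/
def weakDeriv (v : ℝ → ℝ) : ℝ → ℝ :=
  if hv : ∃ g, MemLp g 2 leb ∧ IsWeakDeriv v g then Classical.choose hv else 0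

/-- `v ∈ H²(Ω)`; the second weak derivative is then `weakDeriv (weakDeriv v)`. -/
def MemH2 (v : ℝ → ℝ) : Prop := MemH1 v ∧ MemH1 (weakDeriv v)

/-- The norm of `L²(Ω)`. -/
def L2Norm (v : ℝ → ℝ) : ℝ := (eLpNorm v 2 leb).toReal

/-- The norm of `H¹(Ω)`. -/
def H1Norm (v : ℝ → ℝ) : ℝ := Real.sqrt (L2Norm v ^ 2 + L2Norm (weakDeriv v) ^ 2)

/-- `v ∈ H¹₀(Ω)`, the closure of the test functions on `Ω` in `H¹(Ω)`. -/
def MemH10 (v : ℝ → ℝ) : Prop :=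
  MemH1 v ∧ ∀ ε > 0, ∃ η : 𝓓(Omega, ℝ), H1Norm (fun x => v x - η x) < ε

/-! ### The obstacle problem and its discrete Morse semiflow -/

def alpha (q r : ℝ) : ℝ := (r - q - 1) / 2

def beta (q r : ℝ) : ℝ := alpha q r ^ 2 + r

/-- The obstacle `φ(x) = e^{αx} max(e^x - 1, 0)`. -/
def phi (q r : ℝ) (x : ℝ) : ℝ := Real.exp (alpha q r * x) * max (Real.exp x - 1) 0

/-- The convex set `𝒦` of admissible functions. -/
def Admissible (q r : ℝ) : Set (ℝ → ℝ) :=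
  {v | MemH1 v ∧ MemH10 (fun x => v x - phi q r x) ∧ ∀ᵐ x ∂leb, phi q r x ≤ v x}

/-- The functional `J_m`, where `w` stands for `u_{m-1}`. -/
def J (q r h : ℝ) (w v : ℝ → ℝ) : ℝ :=
  (1 / 2) * ∫ x, (|v x - w x| ^ 2 / h + weakDeriv v x ^ 2 + beta q r * v x ^ 2) ∂leb

/-- `u 0, …, u ⌊T / h⌋` is the discrete Morse semiflow with time step `h`: `u 0 = φ`, and `u (m + 1)`
minimizes over `𝒦` the functional built from `u m`. As usual, the elements of `H¹(Ω)` are identified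
with their continuous representatives on `[-1, 1]`. -/
structure IsDMS (q r T h : ℝ) (u : ℕ → ℝ → ℝ) : Prop where
  zero : EqOn (u 0) (phi q r) (Icc (-1) 1)
  continuousOn : ∀ m < ⌊T / h⌋₊, ContinuousOn (u (m + 1)) (Icc (-1) 1)
  mem : ∀ m < ⌊T / h⌋₊, u (m + 1) ∈ Admissible q r
  minimal : ∀ m < ⌊T / h⌋₊, ∀ v ∈ Admissible q r, J q r h (u m) (u (m + 1)) ≤ J q r h (u m) v

/-! ### Solutions of the elliptic variational inequality

`min {(v - w) / h - v_xx + β v, v - φ} = 0` in `Ω`, `v(±1) = φ(±1)`. -/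

/-- The left-hand side at the point `x`, with the number `X` in place of `v_xx(x)`. -/
def viOp (q r h : ℝ) (w v : ℝ → ℝ) (x X : ℝ) : ℝ :=
  min ((v x - w x) / h - X + beta q r * v x) (v x - phi q r x)

/-- Solutions in the almost everywhere sense. -/
structure IsAESolution (q r h : ℝ) (w v : ℝ → ℝ) : Prop where
  continuousOn : ContinuousOn v (Icc (-1) 1)
  memH2 : MemH2 v
  eq_zero : ∀ᵐ x ∂leb, viOp q r h w v x (weakDeriv (weakDeriv v) x) = 0
  left : v (-1) = phi q r (-1)
  right : v 1 = phi q r 1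

/-- Solutions in the viscosity sense: continuous functions on `[-1, 1]` that are both a viscosity
subsolution and a viscosity supersolution in `Ω` and take the boundary values. -/
structure IsViscositySolution (q r h : ℝ) (w v : ℝ → ℝ) : Prop where
  continuousOn : ContinuousOn v (Icc (-1) 1)
  sub : ∀ ψ : ℝ → ℝ, ContDiff ℝ 2 ψ → ∀ x ∈ (Omega : Set ℝ),
    IsLocalMax (fun y => v y - ψ y) x → viOp q r h w v x (deriv (deriv ψ) x) ≤ 0
  super : ∀ ψ : ℝ → ℝ, ContDiff ℝ 2 ψ → ∀ x ∈ (Omega : Set ℝ),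
    IsLocalMin (fun y => v y - ψ y) x → 0 ≤ viOp q r h w v x (deriv (deriv ψ) x)
  left : v (-1) = phi q r (-1)
  right : v 1 = phi q r 1

end DMSBS

end

/-!
The discrete Morse semiflow for the obstacle problem on `Ω = (-1, 1)`.

In one dimension `H¹(Ω)` is the space of primitives of square integrable functions
(`IsPrimitive`): one direction is integration by parts for absolutely continuous functions, the
other the du Bois-Reymond lemma. The latter also shows that the orthogonal complement in `L²(Ω)` of
the derivatives of test functions consists of the constants, so that `H¹₀(Ω)` is given by vanishing
boundary values (`memH10_iff`).

*Existence.* With `λ = 1 / h + β`, the functional is, up to a constant, half the squared distance in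
`L²(Ω) × L²(Ω)` from `(√λ v, v_x)` to a fixed point. These pairs form a closed convex set as `v`
ranges over `𝒦`, and the minimizer is a projection (`exists_minimizer`).

*Regularity.* Let `u` be a minimizer, `k = (u - w) / h + β u` and `K_xx = k`. The first variation in
the direction of a hat function is a difference of two slopes of `u - K` (`first_variation_hat`).
Hence `u - K` is concave, and it is also convex on intervals where `u > φ`, since there variations
of both signs are admissible. The obstacle is semiconvex, and lies below `u` with equality on the
contact set, so `u` inherits midpoint convexity after adding `M` with `M_xx = max (-k) C`, where `C`
depends on `q` and `r` only. Being semiconcave and semiconvex, `u` has a Lipschitz derivative, with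
`min k (-C) ≤ u_xx ≤ k` almost everywhere and `u_xx = k` off the contact set
(`exists_second_derivative`, `minimizer_regularity`). This is the variational inequality in the
almost everywhere sense together with the bound `|u_xx| ≤ |k| + C`.

*Uniqueness.* Almost everywhere solutions are viscosity solutions
(`IsAESolution.isViscositySolution`), so it suffices to compare two viscosity solutions `u`, `v`. At
a positive maximum of `v - u` one has `v > u ≥ φ`, so that near this point `v` solves the linear
equation. In one dimension it is then twice continuously differentiable, hence a legitimate test
function for `u`, and this is contradictory (`IsViscositySolution.le`).

*Estimates.* Comparing `J_m(u_m)` with `J_m(u_{m-1})` and telescoping bounds the difference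
quotients and the `H¹(Ω)` norms by the energy of `φ`; the bound on `u_xx` does the rest
(`IsDMS.estimate`).
-/

noncomputable section

namespace DMSBS

/-! ### Integration on `Ω` -/

lemma leb_eq : leb = volume.restrict (Ioo (-1 : ℝ) 1) := rfl

instance isFiniteMeasure_leb : IsFiniteMeasure leb := by
  rw [leb_eq]; infer_instance

lemma leb_real_univ : leb.real univ = 2 := by
  rw [leb_eq, measureReal_def, Measure.restrict_apply_univ, Real.volume_Ioo]
  norm_num

lemma integral_leb (f : ℝ → ℝ) : ∫ x, f x ∂leb = ∫ x in (-1 : ℝ)..1, f x := by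
  rw [intervalIntegral.integral_of_le (by norm_num), integral_Ioc_eq_integral_Ioo, leb_eq]

lemma integrable_leb_iff {f : ℝ → ℝ} :
    Integrable f leb ↔ IntervalIntegrable f volume (-1) 1 := by
  rw [intervalIntegrable_iff_integrableOn_Ioo_of_le (by norm_num), leb_eq, IntegrableOn]

lemma ae_leb_iff {p : ℝ → Prop} : (∀ᵐ x ∂leb, p x) ↔ ∀ᵐ x, x ∈ Ioo (-1 : ℝ) 1 → p x := by
  rw [leb_eq, ae_restrict_iff' measurableSet_Ioo]

lemma ae_leb_of_forall {p : ℝ → Prop} (hp : ∀ x ∈ Ioo (-1 : ℝ) 1, p x) : ∀ᵐ x ∂leb, p x :=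
  ae_leb_iff.2 (Filter.Eventually.of_forall hp)

lemma memLp_of_continuousOn {f : ℝ → ℝ} (hf : ContinuousOn f (Icc (-1) 1)) : MemLp f 2 leb := by
  obtain ⟨C, hC⟩ := isCompact_Icc.exists_bound_of_continuousOn hf
  refine MemLp.of_bound ?_ C (ae_leb_of_forall fun x hx => hC x (Ioo_subset_Icc_self hx))
  exact (hf.mono Ioo_subset_Icc_self).aestronglyMeasurable measurableSet_Ioo

lemma integrable_of_memLp {f : ℝ → ℝ} (hf : MemLp f 2 leb) : Integrable f leb :=
  hf.integrable (by norm_num)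

lemma integrable_mul_of_memLp {f g : ℝ → ℝ} (hf : MemLp f 2 leb) (hg : MemLp g 2 leb) :
    Integrable (fun x => f x * g x) leb := hf.integrable_mul hg

lemma integrable_sq_of_memLp {f : ℝ → ℝ} (hf : MemLp f 2 leb) :
    Integrable (fun x => f x ^ 2) leb := hf.integrable_sq

lemma intervalIntegrable_of_memLp {g : ℝ → ℝ} (hv : MemLp g 2 leb) {x : ℝ}
    (hx : x ∈ Icc (-1 : ℝ) 1) : IntervalIntegrable g volume (-1) x :=
  (integrable_leb_iff.1 (integrable_of_memLp hv)).mono_set (by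
    rw [uIcc_of_le hx.1, uIcc_of_le (by norm_num)]
    exact Icc_subset_Icc le_rfl hx.2)

lemma L2Norm_nonneg (f : ℝ → ℝ) : 0 ≤ L2Norm f := ENNReal.toReal_nonneg

lemma L2Norm_sq {f : ℝ → ℝ} (hf : MemLp f 2 leb) : L2Norm f ^ 2 = ∫ x, f x ^ 2 ∂leb := by
  have h := hf.eLpNorm_eq_integral_rpow_norm (by norm_num) (by norm_num)
  have h0 : 0 ≤ ∫ x, f x ^ 2 ∂leb := integral_nonneg fun x => sq_nonneg _
  rw [L2Norm, h, ENNReal.toReal_ofReal (by positivity)]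
  simp only [ENNReal.toReal_ofNat, Real.rpow_ofNat, Real.norm_eq_abs, sq_abs]
  rw [← Real.rpow_natCast, ← Real.rpow_mul h0]
  norm_num

lemma L2Norm_congr {f g : ℝ → ℝ} (h : f =ᵐ[leb] g) : L2Norm f = L2Norm g := by
  rw [L2Norm, L2Norm, eLpNorm_congr_ae h]

/-- The Cauchy-Schwarz inequality against the constant `1`. -/
lemma sq_integral_abs_le {f : ℝ → ℝ} (hf : MemLp f 2 leb) :
    (∫ x, |f x| ∂leb) ^ 2 ≤ 2 * ∫ x, f x ^ 2 ∂leb := by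
  set c := (∫ x, |f x| ∂leb) / 2 with hc
  have h1 : ∫ x, (f x ^ 2 - 2 * c * |f x| + c ^ 2) ∂leb
      = ∫ x, f x ^ 2 ∂leb - 2 * c * ∫ x, |f x| ∂leb + 2 * c ^ 2 := by
    have i1 := integrable_sq_of_memLp hf
    have i2 := (integrable_of_memLp hf).abs.const_mul (2 * c)
    have e := integral_add (i1.sub i2) (integrable_const (μ := leb) (c ^ 2))
    simp only [Pi.sub_apply] at e
    rw [e, integral_sub i1 i2, integral_const_mul, integral_const, leb_real_univ, smul_eq_mul]
  have h2 : 0 ≤ ∫ x, (f x ^ 2 - 2 * c * |f x| + c ^ 2) ∂leb := by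
    refine integral_nonneg fun x => ?_
    have := sq_nonneg (|f x| - c)
    have h3 := sq_abs (f x)
    simp only [Pi.zero_apply]
    nlinarith
  rw [h1] at h2
  have h4 : ∫ x, |f x| ∂leb = 2 * c := by rw [hc]; ring
  rw [h4] at h2 ⊢
  nlinarith

lemma integral_abs_le {f : ℝ → ℝ} (hf : MemLp f 2 leb) : ∫ x, |f x| ∂leb ≤ 2 * L2Norm f := by
  have h := sq_integral_abs_le hf
  rw [← L2Norm_sq hf] at h
  have h2 := L2Norm_nonneg f
  exact (abs_le_of_sq_le_sq' (by nlinarith [sq_nonneg (L2Norm f)]) (by linarith)).2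

/-! ### Primitives of square integrable functions -/

/-- `v` is on `[-1, 1]` a primitive of the square integrable function `g`. By
`exists_isPrimitive_of_memH1`, these `v` are the continuous representatives of the elements of
`H¹(Ω)`, and `g` is then the weak derivative. -/
structure IsPrimitive (v g : ℝ → ℝ) : Prop where
  memLp : MemLp g 2 leb
  eq_integral : ∀ x ∈ Icc (-1 : ℝ) 1, v x = v (-1) + ∫ t in (-1 : ℝ)..x, g t

namespace IsPrimitive

variable {v w g f : ℝ → ℝ}

lemma intervalIntegrable (hv : IsPrimitive v g) : IntervalIntegrable g volume (-1) 1 :=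
  integrable_leb_iff.1 (integrable_of_memLp hv.memLp)

lemma absolutelyContinuous (hv : IsPrimitive v g) :
    AbsolutelyContinuousOnInterval (fun x => v (-1) + ∫ t in (-1 : ℝ)..x, g t) (-1) 1 :=
  (LipschitzWith.const (v (-1))).lipschitzOnWith.absolutelyContinuousOnInterval.add
    (hv.intervalIntegrable.absolutelyContinuousOnInterval_intervalIntegral (by simp))

lemma continuousOn (hv : IsPrimitive v g) : ContinuousOn v (Icc (-1) 1) := by
  have h := hv.absolutelyContinuous.continuousOn
  rw [uIcc_of_le (by norm_num)] at h
  exact h.congr hv.eq_integral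

lemma memLp_self (hv : IsPrimitive v g) : MemLp v 2 leb := memLp_of_continuousOn hv.continuousOn

lemma ae_deriv_eq (hv : IsPrimitive v g) :
    ∀ᵐ x ∂leb, deriv (fun x => v (-1) + ∫ t in (-1 : ℝ)..x, g t) x = g x := by
  rw [ae_leb_iff]
  filter_upwards [hv.intervalIntegrable.ae_hasDerivAt_integral] with x hx hxm
  have hx' : x ∈ uIcc (-1 : ℝ) 1 := by
    rw [uIcc_of_le (by norm_num)]; exact Ioo_subset_Icc_self hxm
  exact ((hx hx' (-1) (by simp)).const_add _).deriv

/-- Integration by parts. -/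
lemma integral_mul_add_mul (hv : IsPrimitive v g) (hw : IsPrimitive w f) :
    ∫ x, (g x * w x + v x * f x) ∂leb = v 1 * w 1 - v (-1) * w (-1) := by
  have h := hv.absolutelyContinuous.integral_deriv_mul_eq_sub hw.absolutelyContinuous
  rw [← integral_leb] at h
  have h1 := hv.eq_integral 1 (by simp)
  have h2 := hw.eq_integral 1 (by simp)
  simp only [intervalIntegral.integral_same, add_zero, ← h1, ← h2] at h
  rw [← h]
  refine integral_congr_ae ?_
  filter_upwards [hv.ae_deriv_eq, hw.ae_deriv_eq,
    ae_leb_of_forall fun x hx => hv.eq_integral x (Ioo_subset_Icc_self hx),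
    ae_leb_of_forall fun x hx => hw.eq_integral x (Ioo_subset_Icc_self hx)] with x e1 e2 e3 e4
  rw [e1, e2, ← e3, ← e4]

lemma integral_mul_eq_neg (hv : IsPrimitive v g) (hw : IsPrimitive w f)
    (h0 : w (-1) = 0) (h1 : w 1 = 0) :
    ∫ x, v x * f x ∂leb = -∫ x, g x * w x ∂leb := by
  have h := hv.integral_mul_add_mul hw
  rw [integral_add (integrable_mul_of_memLp hv.memLp hw.memLp_self)
    (integrable_mul_of_memLp hv.memLp_self hw.memLp), h0, h1] at h
  linarith

lemma of_continuousOn_of_hasDerivAt_off_countable {s : Set ℝ} (hs : s.Countable)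
    (hv : ContinuousOn v (Icc (-1) 1)) (hg : MemLp g 2 leb)
    (h : ∀ x ∈ Ioo (-1 : ℝ) 1 \ s, HasDerivAt v (g x) x) : IsPrimitive v g := by
  refine ⟨hg, fun x hx => ?_⟩
  rw [integral_eq_of_hasDerivAt_off_countable_of_le v g hx.1 hs
    (hv.mono (Icc_subset_Icc le_rfl hx.2))
    (fun y hy => h y ⟨⟨hy.1.1, hy.1.2.trans_le hx.2⟩, hy.2⟩)
    (intervalIntegrable_of_memLp hg hx)]
  ring

lemma of_continuousOn_of_hasDerivAt (hv : ContinuousOn v (Icc (-1) 1)) (hg : MemLp g 2 leb)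
    (h : ∀ x ∈ Ioo (-1 : ℝ) 1, HasDerivAt v (g x) x) : IsPrimitive v g :=
  of_continuousOn_of_hasDerivAt_off_countable countable_empty hv hg fun x hx => h x hx.1

lemma congr (hv : IsPrimitive v g) (h : EqOn w v (Icc (-1) 1)) : IsPrimitive w g := by
  refine ⟨hv.memLp, fun x hx => ?_⟩
  rw [h hx, h (by simp : (-1 : ℝ) ∈ Icc (-1 : ℝ) 1)]
  exact hv.eq_integral x hx

lemma intervalIntegrable_of_mem (hv : IsPrimitive v g) {x : ℝ} (hx : x ∈ Icc (-1 : ℝ) 1) :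
    IntervalIntegrable g volume (-1) x := intervalIntegrable_of_memLp hv.memLp hx

lemma add (hv : IsPrimitive v g) (hw : IsPrimitive w f) :
    IsPrimitive (fun x => v x + w x) (fun x => g x + f x) := by
  refine ⟨hv.memLp.add hw.memLp, fun x hx => ?_⟩
  rw [intervalIntegral.integral_add (hv.intervalIntegrable_of_mem hx)
    (hw.intervalIntegrable_of_mem hx), hv.eq_integral x hx, hw.eq_integral x hx]
  ring

lemma const_mul (hv : IsPrimitive v g) (c : ℝ) :
    IsPrimitive (fun x => c * v x) (fun x => c * g x) := by
  refine ⟨hv.memLp.const_mul c, fun x hx => ?_⟩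
  rw [intervalIntegral.integral_const_mul, hv.eq_integral x hx]
  ring

lemma sub (hv : IsPrimitive v g) (hw : IsPrimitive w f) :
    IsPrimitive (fun x => v x - w x) (fun x => g x - f x) := by
  have h := hv.add (hw.const_mul (-1))
  simpa only [neg_mul, one_mul, ← sub_eq_add_neg] using h

/-- The trace inequality at the left end point. -/
lemma abs_left_le (hv : IsPrimitive v g) : |v (-1)| ≤ L2Norm v + 2 * L2Norm g := by
  have h1 : ∀ x ∈ Ioo (-1 : ℝ) 1, |v (-1)| ≤ |v x| + ∫ t, |g t| ∂leb := by
    intro x hx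
    have h2 := hv.eq_integral x (Ioo_subset_Icc_self hx)
    have h3 : |∫ t in (-1 : ℝ)..x, g t| ≤ ∫ t, |g t| ∂leb := by
      refine (intervalIntegral.abs_integral_le_integral_abs hx.1.le).trans ?_
      rw [integral_leb]
      exact intervalIntegral.integral_mono_interval le_rfl hx.1.le hx.2.le
        (Filter.Eventually.of_forall fun _ => abs_nonneg _) hv.intervalIntegrable.abs
    have h4 : v (-1) = v x - ∫ t in (-1 : ℝ)..x, g t := by linarith
    rw [h4]
    exact (abs_sub _ _).trans (by linarith)
  have i1 := (integrable_of_memLp hv.memLp_self).abs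
  have h5 : ∫ _x, |v (-1)| ∂leb ≤ ∫ x, (|v x| + ∫ t, |g t| ∂leb) ∂leb :=
    integral_mono_ae (integrable_const _) (i1.add (integrable_const _)) (ae_leb_of_forall h1)
  rw [integral_add i1 (integrable_const _), integral_const, integral_const, leb_real_univ,
    smul_eq_mul, smul_eq_mul] at h5
  linarith [integral_abs_le hv.memLp_self, integral_abs_le hv.memLp]

lemma abs_right_sub_left_le (hv : IsPrimitive v g) : |v 1 - v (-1)| ≤ 2 * L2Norm g := by
  have h := hv.eq_integral 1 (by simp)
  have h2 : v 1 - v (-1) = ∫ t in (-1 : ℝ)..1, g t := by linarith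
  rw [h2]
  refine (intervalIntegral.abs_integral_le_integral_abs (by norm_num)).trans ?_
  rw [← integral_leb]
  exact integral_abs_le hv.memLp

end IsPrimitive

/-! ### Test functions and the du Bois-Reymond lemma -/

lemma testFunction_eq_zero (η : 𝓓(Omega, ℝ)) {x : ℝ} (hx : x ∉ Ioo (-1 : ℝ) 1) : η x = 0 := by
  by_contra h
  exact hx (η.tsupport_subset (subset_tsupport _ h))

lemma isPrimitive_testFunction (η : 𝓓(Omega, ℝ)) : IsPrimitive η (deriv η) := by
  have hd : ContDiff ℝ ∞ (η : ℝ → ℝ) := η.contDiff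
  refine IsPrimitive.of_continuousOn_of_hasDerivAt η.continuous.continuousOn
    (memLp_of_continuousOn (hd.continuous_deriv (by simp)).continuousOn) fun x _ => ?_
  exact (hd.differentiable (by simp) x).hasDerivAt

lemma exists_Icc_of_isCompact_subset {K : Set ℝ} (hK : IsCompact K) (hs : K ⊆ Ioo (-1 : ℝ) 1) :
    ∃ a : ℝ, 0 < a ∧ a < 1 ∧ K ⊆ Icc (-a) a := by
  rcases K.eq_empty_or_nonempty with rfl | hne
  · exact ⟨1 / 2, by norm_num, by norm_num, empty_subset _⟩
  obtain ⟨y, hy, hmax⟩ := hK.exists_isMaxOn hne continuous_abs.continuousOn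
  have h1 : |y| < 1 := abs_lt.2 (hs hy)
  refine ⟨(1 + |y|) / 2, by positivity, by linarith, fun x hx => ?_⟩
  have h2 : |x| ≤ |y| := hmax hx
  exact abs_le.1 (by linarith)

/-- A smooth function that has compact support in `Ω` and mean zero is the derivative of a test
function. -/
lemma exists_testFunction_deriv_eq {ζ : ℝ → ℝ} (hs : ContDiff ℝ ∞ ζ) (hc : HasCompactSupport ζ)
    (hsub : tsupport ζ ⊆ Ioo (-1 : ℝ) 1) (h0 : ∫ x, ζ x ∂leb = 0) :
    ∃ η : 𝓓(Omega, ℝ), deriv η = ζ := by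
  obtain ⟨a, ha0, ha1, ha⟩ := exists_Icc_of_isCompact_subset hc hsub
  have hz : ∀ x, x ∉ Icc (-a) a → ζ x = 0 := fun x hx => by
    by_contra h; exact hx (ha (subset_tsupport _ h))
  let F : ℝ → ℝ := fun x => ∫ t in (-1 : ℝ)..x, ζ t
  have hF : ∀ x, HasDerivAt F (ζ x) x := fun x =>
    (hs.continuous.integral_hasStrictDerivAt (-1) x).hasDerivAt
  have hdF : deriv F = ζ := funext fun x => (hF x).deriv
  have hF0 : ∀ x, x ∉ Icc (-a) a → F x = 0 := by
    intro x hx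
    rcases lt_or_ge x (-a) with h | h
    · have : ∫ t in (-1 : ℝ)..x, ζ t = ∫ t in (-1 : ℝ)..x, (0 : ℝ) := by
        refine intervalIntegral.integral_congr fun t ht => hz t fun ht' => ?_
        have h2 : t ≤ max (-1) x := ht.2
        have : max (-1) x < -a := max_lt (by linarith) h
        linarith [ht'.1]
      simpa [F] using this
    · have hxa : a < x := by by_contra hh; exact hx ⟨h, not_lt.1 hh⟩
      have e1 : ∫ t in (1 : ℝ)..x, ζ t = ∫ t in (1 : ℝ)..x, (0 : ℝ) := by
        refine intervalIntegral.integral_congr fun t ht => hz t fun ht' => ?_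
        have h2 : min 1 x ≤ t := ht.1
        have : a < min 1 x := lt_min ha1 hxa
        linarith [ht'.2]
      have e2 : F x = (∫ t in (-1 : ℝ)..1, ζ t) + ∫ t in (1 : ℝ)..x, ζ t :=
        (intervalIntegral.integral_add_adjacent_intervals
          (hs.continuous.intervalIntegrable _ _) (hs.continuous.intervalIntegrable _ _)).symm
      rw [e2, e1, ← integral_leb, h0]
      simp
  have hts : tsupport F ⊆ Icc (-a) a :=
    closure_minimal (fun x hx => by by_contra h; exact hx (hF0 x h)) isClosed_Icc
  refine ⟨⟨F, ?_, ?_, ?_⟩, hdF⟩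
  · refine contDiff_infty_iff_deriv.2 ⟨fun x => (hF x).differentiableAt, ?_⟩
    rw [hdF]; exact hs
  · exact isCompact_Icc.of_isClosed_subset (isClosed_tsupport _) hts
  · exact hts.trans (Icc_subset_Ioo (by linarith) ha1)

/-- There is a smooth function with unit mass and compact support in `Ω`. -/
lemma exists_unit_mass : ∃ ρ : ℝ → ℝ, ContDiff ℝ ∞ ρ ∧ HasCompactSupport ρ ∧
    tsupport ρ ⊆ Ioo (-1 : ℝ) 1 ∧ ∫ x, ρ x ∂leb = 1 := by
  let b : ContDiffBump (0 : ℝ) := ⟨1 / 4, 1 / 2, by norm_num, by norm_num⟩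
  have hts : tsupport (b.normed volume) ⊆ Ioo (-1 : ℝ) 1 := by
    rw [b.tsupport_normed_eq, Real.closedBall_eq_Icc]
    exact Icc_subset_Ioo (by norm_num [b]) (by norm_num [b])
  refine ⟨b.normed volume, b.contDiff_normed, b.hasCompactSupport_normed, hts, ?_⟩
  rw [leb_eq, setIntegral_eq_integral_of_forall_compl_eq_zero, b.integral_normed]
  intro x hx
  by_contra h
  exact hx (hts (subset_tsupport _ h))

/-- The du Bois-Reymond lemma. -/
lemma ae_eq_const_of_integral_mul_deriv_eq_zero {f : ℝ → ℝ} (hf : Integrable f leb)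
    (h : ∀ η : 𝓓(Omega, ℝ), ∫ x, f x * deriv η x ∂leb = 0) :
    ∃ c : ℝ, ∀ᵐ x ∂leb, f x = c := by
  obtain ⟨ρ, hρs, hρc, hρt, hρ1⟩ := exists_unit_mass
  set c := ∫ x, f x * ρ x ∂leb with hc
  have hint : ∀ ζ : ℝ → ℝ, Continuous ζ → HasCompactSupport ζ →
      Integrable (fun x => f x * ζ x) leb := by
    intro ζ hζ hζc
    obtain ⟨C, hC⟩ := hζ.bounded_above_of_compact_support hζc
    exact hf.mul_bdd (c := C) hζ.aestronglyMeasurable (Filter.Eventually.of_forall hC)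
  have hint' : ∀ ζ : ℝ → ℝ, Continuous ζ → Integrable ζ leb := fun ζ hζ =>
    integrable_of_memLp (memLp_of_continuousOn hζ.continuousOn)
  have hfc : Integrable (fun x => f x - c) leb := hf.sub (integrable_const c)
  have key : ∀ᵐ x, x ∈ Ioo (-1 : ℝ) 1 → f x - c = 0 := by
    refine isOpen_Ioo.ae_eq_zero_of_integral_contDiff_smul_eq_zero
      (IntegrableOn.locallyIntegrableOn (by rw [leb_eq] at hfc; exact hfc)) ?_
    intro ζ hζs hζc hζt
    -- Subtracting a multiple of `ρ` makes the mean of `ζ` vanish.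
    set m := ∫ x, ζ x ∂leb with hm
    have hmean : ∫ x, (ζ x - m * ρ x) ∂leb = 0 := by
      rw [integral_sub (hint' ζ hζs.continuous) ((hint' ρ hρs.continuous).const_mul m),
        integral_const_mul, hρ1]
      ring
    have hts : tsupport (fun x => ζ x - m * ρ x) ⊆ tsupport ζ ∪ tsupport ρ := by
      refine closure_minimal (fun x hx => ?_) ((isClosed_tsupport _).union (isClosed_tsupport _))
      by_contra hx'
      rw [mem_union, not_or] at hx'
      exact hx (by simp [image_eq_zero_of_notMem_tsupport hx'.1,
        image_eq_zero_of_notMem_tsupport hx'.2])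
    obtain ⟨η, hη⟩ := exists_testFunction_deriv_eq (ζ := fun x => ζ x - m * ρ x)
      (hζs.sub (contDiff_const.mul hρs))
      ((IsCompact.union hζc hρc).of_isClosed_subset (isClosed_tsupport _) hts)
      (hts.trans (union_subset hζt hρt)) hmean
    have h1 := h η
    rw [hη] at h1
    have h2 : ∫ x, f x * (ζ x - m * ρ x) ∂leb = ∫ x, f x * ζ x ∂leb - m * c := by
      rw [hc, ← integral_const_mul, ← integral_sub (hint ζ hζs.continuous hζc)
        ((hint ρ hρs.continuous hρc).const_mul m)]
      exact integral_congr_ae (Filter.Eventually.of_forall fun x => by simp only; ring)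
    have h3 : ∫ x, ζ x • (f x - c) ∂leb = 0 := by
      have h4 : ∫ x, ζ x • (f x - c) ∂leb = ∫ x, f x * ζ x ∂leb - c * m := by
        rw [hm, ← integral_const_mul, ← integral_sub (hint ζ hζs.continuous hζc)
          ((hint' ζ hζs.continuous).const_mul c)]
        exact integral_congr_ae (Filter.Eventually.of_forall fun x => by
          simp only [smul_eq_mul]; ring)
      rw [h4]; linarith
    rw [← h3, leb_eq, setIntegral_eq_integral_of_forall_compl_eq_zero]
    intro x hx
    rw [image_eq_zero_of_notMem_tsupport fun hx' => hx (hζt hx'), zero_smul]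
  refine ⟨c, ae_leb_iff.2 ?_⟩
  filter_upwards [key] with x hx hxm
  linarith [hx hxm]

/-! ### `H¹(Ω)` and `H¹₀(Ω)` in terms of primitives -/

lemma isWeakDeriv_of_ae_eq_isPrimitive {v w g : ℝ → ℝ} (hv : IsPrimitive v g)
    (hw : w =ᵐ[leb] v) : IsWeakDeriv w g := by
  have hwi : Integrable w leb := (integrable_of_memLp hv.memLp_self).congr hw.symm
  have hgi := integrable_of_memLp hv.memLp
  refine ⟨IntegrableOn.locallyIntegrableOn hwi, IntegrableOn.locallyIntegrableOn hgi,
    fun η => ?_⟩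
  rw [← hv.integral_mul_eq_neg (isPrimitive_testFunction η)
    (testFunction_eq_zero η (by simp)) (testFunction_eq_zero η (by simp))]
  exact integral_congr_ae (hw.mono fun x hx => by simp only [hx])

lemma memH1_of_ae_eq_isPrimitive {v w g : ℝ → ℝ} (hv : IsPrimitive v g)
    (hw : w =ᵐ[leb] v) : MemH1 w :=
  ⟨hv.memLp_self.ae_eq hw.symm, g, hv.memLp, isWeakDeriv_of_ae_eq_isPrimitive hv hw⟩

lemma MemH1.weakDeriv_spec {v : ℝ → ℝ} (hv : MemH1 v) :
    MemLp (weakDeriv v) 2 leb ∧ IsWeakDeriv v (weakDeriv v) := by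
  have h : weakDeriv v = Classical.choose hv.2 := dif_pos hv.2
  rw [h]
  exact Classical.choose_spec hv.2

/-- An element of `H¹(Ω)` has a continuous representative, which is a primitive of its weak
derivative. -/
lemma exists_isPrimitive_of_memH1 {v g : ℝ → ℝ} (hv : MemLp v 2 leb) (hg : MemLp g 2 leb)
    (h : IsWeakDeriv v g) : ∃ V, IsPrimitive V g ∧ v =ᵐ[leb] V := by
  have hG : IsPrimitive (fun x => ∫ t in (-1 : ℝ)..x, g t) g := ⟨hg, fun x _ => by simp⟩
  have hvi := integrable_of_memLp hv
  obtain ⟨c, hc⟩ := ae_eq_const_of_integral_mul_deriv_eq_zero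
    (hvi.sub (integrable_of_memLp hG.memLp_self)) fun η => by
      have hη := isPrimitive_testFunction η
      have h1 := hG.integral_mul_eq_neg hη
        (testFunction_eq_zero η (by simp)) (testFunction_eq_zero η (by simp))
      simp only [Pi.sub_apply, sub_mul]
      rw [integral_sub (integrable_mul_of_memLp hv hη.memLp)
        (integrable_mul_of_memLp hG.memLp_self hη.memLp), h.2.2 η, h1, sub_self]
  refine ⟨fun x => c + ∫ t in (-1 : ℝ)..x, g t, ⟨hg, fun x _ => by simp⟩, ?_⟩
  filter_upwards [hc] with x hx
  simp only [Pi.sub_apply] at hx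
  linarith

lemma eqOn_of_ae_eq {v w : ℝ → ℝ} (hv : ContinuousOn v (Icc (-1) 1))
    (hw : ContinuousOn w (Icc (-1) 1)) (h : v =ᵐ[leb] w) : EqOn v w (Icc (-1) 1) := by
  have h1 : v =ᵐ[volume.restrict (Icc (-1 : ℝ) 1)] w := by
    rw [← Measure.restrict_congr_set (Ioo_ae_eq_Icc (μ := volume) (a := (-1 : ℝ)) (b := 1))]
    exact h
  exact Measure.eqOn_Icc_of_ae_eq volume (by norm_num) h1 hv hw

lemma isPrimitive_weakDeriv {v : ℝ → ℝ} (hc : ContinuousOn v (Icc (-1) 1)) (hv : MemH1 v) :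
    IsPrimitive v (weakDeriv v) := by
  obtain ⟨V, hV, hvV⟩ := exists_isPrimitive_of_memH1 hv.1 hv.weakDeriv_spec.1 hv.weakDeriv_spec.2
  exact hV.congr (eqOn_of_ae_eq hc hV.continuousOn hvV)

/-- The derivative of an absolutely continuous function is determined almost everywhere. -/
lemma IsPrimitive.ae_eq_deriv {v g f : ℝ → ℝ} (hv : IsPrimitive v g) (hw : IsPrimitive v f) :
    g =ᵐ[leb] f := by
  have h1 : EqOn (fun x => v (-1) + ∫ t in (-1 : ℝ)..x, g t)
      (fun x => v (-1) + ∫ t in (-1 : ℝ)..x, f t) (Ioo (-1) 1) := fun x hx => by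
    have hx' := Ioo_subset_Icc_self hx
    simp only [← hv.eq_integral x hx', ← hw.eq_integral x hx']
  filter_upwards [hv.ae_deriv_eq, hw.ae_deriv_eq,
    ae_leb_of_forall (p := fun x => x ∈ Ioo (-1 : ℝ) 1) fun _ h => h] with x e1 e2 hx
  rw [← e1, ← e2]
  exact (h1.eventuallyEq_of_mem (isOpen_Ioo.mem_nhds hx)).deriv_eq

lemma weakDeriv_ae_eq {v w g : ℝ → ℝ} (hv : IsPrimitive v g) (hw : w =ᵐ[leb] v) :
    weakDeriv w =ᵐ[leb] g := by
  have hw1 := memH1_of_ae_eq_isPrimitive hv hw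
  obtain ⟨V, hV, hwV⟩ :=
    exists_isPrimitive_of_memH1 hw1.1 hw1.weakDeriv_spec.1 hw1.weakDeriv_spec.2
  exact (hV.congr (eqOn_of_ae_eq hv.continuousOn hV.continuousOn
    (hw.symm.trans hwV))).ae_eq_deriv hv

lemma IsPrimitive.weakDeriv_ae_eq {v g : ℝ → ℝ} (hv : IsPrimitive v g) :
    weakDeriv v =ᵐ[leb] g := DMSBS.weakDeriv_ae_eq hv (ae_eq_refl v)

lemma IsPrimitive.memH1 {v g : ℝ → ℝ} (hv : IsPrimitive v g) : MemH1 v :=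
  memH1_of_ae_eq_isPrimitive hv (ae_eq_refl v)

lemma H1Norm_eq {v w g : ℝ → ℝ} (hv : IsPrimitive v g) (hw : w =ᵐ[leb] v) :
    H1Norm w = √(L2Norm v ^ 2 + L2Norm g ^ 2) := by
  rw [H1Norm, L2Norm_congr hw, L2Norm_congr (weakDeriv_ae_eq hv hw)]

/-- The derivatives of the test functions, as a subspace of `L²(Ω)`. -/
def testDerivs : Submodule ℝ (Lp ℝ 2 leb) where
  carrier := {f | ∃ η : 𝓓(Omega, ℝ), f =ᵐ[leb] deriv η}
  zero_mem' := ⟨0, by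
    have h : deriv ((0 : 𝓓(Omega, ℝ)) : ℝ → ℝ) = 0 := by
      simp
    rw [h]; exact Lp.coeFn_zero _ _ _⟩
  add_mem' := by
    rintro a b ⟨η, hη⟩ ⟨ζ, hζ⟩
    refine ⟨η + ζ, ?_⟩
    filter_upwards [hη, hζ, Lp.coeFn_add a b] with x h1 h2 h3
    have d1 : DifferentiableAt ℝ η x := (η.contDiff.differentiable (by simp)) x
    have d2 : DifferentiableAt ℝ ζ x := (ζ.contDiff.differentiable (by simp)) x
    rw [h3, Pi.add_apply, h1, h2, FunLike.coe_add, deriv_add d1 d2]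
  smul_mem' := by
    rintro c a ⟨η, hη⟩
    refine ⟨c • η, ?_⟩
    filter_upwards [hη, Lp.coeFn_smul c a] with x h1 h2
    have d1 : DifferentiableAt ℝ η x := (η.contDiff.differentiable (by simp)) x
    rw [h2, Pi.smul_apply, h1, FunLike.coe_smul, deriv_const_smul c d1]

lemma L2Norm_toLp_sub (f : ℝ → ℝ) (hf : MemLp f 2 leb) (F : Lp ℝ 2 leb) :
    ‖hf.toLp f - F‖ = L2Norm (fun x => f x - F x) := by
  rw [Lp.norm_def, L2Norm]
  congr 1
  refine eLpNorm_congr_ae ?_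
  filter_upwards [Lp.coeFn_sub (hf.toLp f) F, hf.coeFn_toLp] with x h1 h2
  rw [h1, Pi.sub_apply, h2]

/-- Derivatives of test functions are dense among the square integrable functions of mean zero:
by the du Bois-Reymond lemma their orthogonal complement in `L²(Ω)` consists of the constants. -/
lemma exists_testFunction_L2Norm_sub_deriv_lt {g : ℝ → ℝ} (hg : MemLp g 2 leb)
    (h0 : ∫ x, g x ∂leb = 0) {ε : ℝ} (hε : 0 < ε) :
    ∃ η : 𝓓(Omega, ℝ), L2Norm (fun x => g x - deriv η x) < ε := by
  have hmem : hg.toLp g ∈ testDerivs.topologicalClosure := by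
    rw [← Submodule.orthogonal_orthogonal_eq_closure, Submodule.mem_orthogonal]
    intro f hf
    rw [Submodule.mem_orthogonal] at hf
    have hfL := Lp.memLp f
    obtain ⟨c, hc⟩ := ae_eq_const_of_integral_mul_deriv_eq_zero
      (integrable_of_memLp hfL) fun η => by
      have hη := (isPrimitive_testFunction η).memLp
      have h1 := hf (hη.toLp _) ⟨η, hη.coeFn_toLp⟩
      rw [L2.inner_def] at h1
      rw [← h1]
      refine integral_congr_ae ?_
      filter_upwards [hη.coeFn_toLp] with x hx
      rw [hx]; simp
    rw [L2.inner_def]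
    have h2 : ∫ x, c * g x ∂leb = 0 := by rw [integral_const_mul, h0, mul_zero]
    rw [← h2]
    refine integral_congr_ae ?_
    filter_upwards [hc, hg.coeFn_toLp] with x h3 h4
    rw [h3, h4]; simp [mul_comm]
  have hcl : hg.toLp g ∈ closure (testDerivs : Set (Lp ℝ 2 leb)) := hmem
  obtain ⟨F, ⟨η, hη⟩, hF⟩ := Metric.mem_closure_iff.1 hcl ε hε
  refine ⟨η, ?_⟩
  rw [dist_eq_norm, L2Norm_toLp_sub] at hF
  rwa [L2Norm_congr (g := fun x => g x - F x) (hη.mono fun x hx => by simp only [hx])]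

/-- The elements of `H¹₀(Ω)` are those whose continuous representative vanishes at `±1`. -/
lemma memH10_iff {v w g : ℝ → ℝ} (hv : IsPrimitive v g) (hw : w =ᵐ[leb] v) :
    MemH10 w ↔ v (-1) = 0 ∧ v 1 = 0 := by
  have hH : ∀ η : 𝓓(Omega, ℝ), H1Norm (fun x => w x - η x)
      = √(L2Norm (fun x => v x - η x) ^ 2 + L2Norm (fun x => g x - deriv η x) ^ 2) := fun η =>
    H1Norm_eq (hv.sub (isPrimitive_testFunction η)) (hw.mono fun x hx => by simp only [hx])
  constructor
  · rintro ⟨-, h⟩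
    have key : ∀ ε > 0, |v (-1)| ≤ 3 * ε ∧ |v 1 - v (-1)| ≤ 2 * ε := by
      intro ε hε
      obtain ⟨η, hη⟩ := h ε hε
      rw [hH η, Real.sqrt_lt' hε] at hη
      have hp := hv.sub (isPrimitive_testFunction η)
      have a1 : L2Norm (fun x => v x - η x) ≤ ε :=
        (abs_le_of_sq_le_sq' (by nlinarith [sq_nonneg (L2Norm fun x => g x - deriv η x)]) hε.le).2
      have a2 : L2Norm (fun x => g x - deriv η x) ≤ ε :=
        (abs_le_of_sq_le_sq' (by nlinarith [sq_nonneg (L2Norm fun x => v x - η x)]) hε.le).2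
      have h1 := hp.abs_left_le
      have h2 := hp.abs_right_sub_left_le
      rw [testFunction_eq_zero η (by simp)] at h1 h2
      rw [testFunction_eq_zero η (by simp)] at h2
      simp only [sub_zero] at h1 h2
      constructor <;> linarith
    have hl : v (-1) = 0 := by
      refine abs_eq_zero.1 (le_antisymm (le_of_forall_pos_le_add fun ε hε => ?_) (abs_nonneg _))
      linarith [(key (ε / 3) (by positivity)).1]
    refine ⟨hl, abs_eq_zero.1 (le_antisymm (le_of_forall_pos_le_add fun ε hε => ?_)
      (abs_nonneg _))⟩
    have := (key (ε / 2) (by positivity)).2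
    rw [hl, sub_zero] at this
    linarith
  · rintro ⟨hl, hr⟩
    refine ⟨memH1_of_ae_eq_isPrimitive hv hw, fun ε hε => ?_⟩
    have h0 : ∫ x, g x ∂leb = 0 := by
      have := hv.eq_integral 1 (by simp)
      rw [hl, hr] at this
      rw [integral_leb]; linarith
    obtain ⟨η, hη⟩ := exists_testFunction_L2Norm_sub_deriv_lt hv.memLp h0
      (show 0 < ε / 5 by positivity)
    refine ⟨η, ?_⟩
    rw [hH η, Real.sqrt_lt' hε]
    have hp := hv.sub (isPrimitive_testFunction η)
    set δ := L2Norm (fun x => g x - deriv η x) with hδ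
    have hδ0 : 0 ≤ δ := L2Norm_nonneg _
    have hb : ∀ x ∈ Ioo (-1 : ℝ) 1, (v x - η x) ^ 2 ≤ (2 * δ) ^ 2 := by
      intro x hx
      have h1 := hp.eq_integral x (Ioo_subset_Icc_self hx)
      rw [hl, testFunction_eq_zero η (x := -1) (by simp), sub_zero, zero_add] at h1
      rw [sq_le_sq, h1, abs_of_nonneg (by positivity : 0 ≤ 2 * δ)]
      refine (intervalIntegral.abs_integral_le_integral_abs hx.1.le).trans
        (le_trans ?_ (integral_abs_le hp.memLp))
      rw [integral_leb]
      exact intervalIntegral.integral_mono_interval le_rfl hx.1.le hx.2.le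
        (Filter.Eventually.of_forall fun _ => abs_nonneg _) hp.intervalIntegrable.abs
    have hL : L2Norm (fun x => v x - η x) ^ 2 ≤ 2 * (2 * δ) ^ 2 := by
      rw [L2Norm_sq hp.memLp_self]
      refine (integral_mono_ae (integrable_sq_of_memLp hp.memLp_self)
        (integrable_const ((2 * δ) ^ 2)) (ae_leb_of_forall hb)).trans ?_
      rw [integral_const, leb_real_univ, smul_eq_mul]
    nlinarith

/-! ### The obstacle and the admissible functions -/

lemma beta_pos {q r : ℝ} (hr : 0 < r) : 0 < beta q r := by
  rw [beta]; positivity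

/-- The smooth function whose positive part is the obstacle. -/
def smoothObstacle (q r x : ℝ) : ℝ :=
  Real.exp ((alpha q r + 1) * x) - Real.exp (alpha q r * x)

lemma smoothObstacle_eq (q r x : ℝ) :
    smoothObstacle q r x = Real.exp (alpha q r * x) * (Real.exp x - 1) := by
  rw [smoothObstacle, mul_sub, ← Real.exp_add, mul_one]
  ring_nf

lemma phi_eq_max (q r x : ℝ) : phi q r x = max (smoothObstacle q r x) 0 := by
  rw [phi, smoothObstacle_eq, mul_max_of_nonneg _ _ (Real.exp_pos _).le, mul_zero]

lemma continuous_phi (q r : ℝ) : Continuous (phi q r) := by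
  unfold phi; fun_prop

lemma hasDerivAt_exp_mul (c x : ℝ) :
    HasDerivAt (fun x => Real.exp (c * x)) (c * Real.exp (c * x)) x := by
  have h := ((hasDerivAt_id x).const_mul c).exp
  simpa [mul_comm] using h

/-- The derivative of the obstacle away from its kink at `0`. -/
def phiDeriv (q r x : ℝ) : ℝ :=
  if 0 < x then (alpha q r + 1) * Real.exp ((alpha q r + 1) * x)
    - alpha q r * Real.exp (alpha q r * x) else 0

lemma isPrimitive_phi (q r : ℝ) : IsPrimitive (phi q r) (phiDeriv q r) := by
  have hg : MemLp (phiDeriv q r) 2 leb := by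
    have hc : Continuous fun x : ℝ => (alpha q r + 1) * Real.exp ((alpha q r + 1) * x)
        - alpha q r * Real.exp (alpha q r * x) := by fun_prop
    have h := (memLp_of_continuousOn hc.continuousOn).indicator (measurableSet_Ioi (a := (0 : ℝ)))
    refine h.ae_eq (Filter.Eventually.of_forall fun x => ?_)
    simp only [indicator, mem_Ioi, phiDeriv]
  refine IsPrimitive.of_continuousOn_of_hasDerivAt_off_countable (countable_singleton 0)
    (continuous_phi q r).continuousOn hg fun x hx => ?_
  have hx0 : x ≠ 0 := hx.2
  rcases lt_or_gt_of_ne hx0 with h | h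
  · have h1 : phiDeriv q r x = 0 := if_neg h.not_gt
    rw [h1]
    refine (hasDerivAt_const x (0 : ℝ)).congr_of_eventuallyEq ?_
    filter_upwards [Iio_mem_nhds h] with y hy
    have : Real.exp y ≤ 1 := Real.exp_le_one_iff.2 (le_of_lt hy)
    rw [phi, max_eq_right (by linarith), mul_zero]
  · have h1 : phiDeriv q r x = _ := if_pos h
    rw [h1]
    refine ((hasDerivAt_exp_mul (alpha q r + 1) x).sub
      (hasDerivAt_exp_mul (alpha q r) x)).congr_of_eventuallyEq ?_
    filter_upwards [Ioi_mem_nhds h] with y hy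
    have : 1 ≤ Real.exp y := Real.one_le_exp (le_of_lt hy)
    have h2 := smoothObstacle_eq q r y
    rw [smoothObstacle] at h2
    rw [phi, max_eq_left (by linarith), Pi.sub_apply, h2]

/-- `v` is the continuous representative of an admissible function, with weak derivative `g`. -/
structure IsCompetitor (q r : ℝ) (v g : ℝ → ℝ) : Prop where
  prim : IsPrimitive v g
  left : v (-1) = phi q r (-1)
  right : v 1 = phi q r 1
  phi_le : ∀ x ∈ Icc (-1 : ℝ) 1, phi q r x ≤ v x

lemma isCompetitor_phi (q r : ℝ) : IsCompetitor q r (phi q r) (phiDeriv q r) :=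
  ⟨isPrimitive_phi q r, rfl, rfl, fun _ _ => le_rfl⟩

lemma IsCompetitor.congr {q r : ℝ} {v w g : ℝ → ℝ} (hv : IsCompetitor q r v g)
    (h : EqOn w v (Icc (-1) 1)) : IsCompetitor q r w g := by
  refine ⟨hv.prim.congr h, ?_, ?_, fun x hx => ?_⟩
  · rw [h (by simp)]; exact hv.left
  · rw [h (by simp)]; exact hv.right
  · rw [h hx]; exact hv.phi_le x hx

lemma IsCompetitor.mem_admissible {q r : ℝ} {v g : ℝ → ℝ} (hv : IsCompetitor q r v g) :
    v ∈ Admissible q r := by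
  refine ⟨hv.prim.memH1, ?_,
    ae_leb_of_forall fun x hx => hv.phi_le x (Ioo_subset_Icc_self hx)⟩
  refine (memH10_iff (hv.prim.sub (isPrimitive_phi q r)) (ae_eq_refl _)).2 ?_
  simp [hv.left, hv.right]

lemma le_of_ae_le {v w : ℝ → ℝ} (hv : ContinuousOn v (Icc (-1) 1))
    (hw : ContinuousOn w (Icc (-1) 1)) (h : ∀ᵐ x ∂leb, v x ≤ w x) :
    ∀ x ∈ Icc (-1 : ℝ) 1, v x ≤ w x := by
  have h1 : EqOn (fun x => max (v x) (w x)) w (Icc (-1) 1) :=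
    eqOn_of_ae_eq (hv.sup hw) hw (h.mono fun x hx => max_eq_right hx)
  exact fun x hx => max_eq_right_iff.1 (h1 hx)

lemma exists_isCompetitor_of_mem_admissible {q r : ℝ} {v : ℝ → ℝ} (hv : v ∈ Admissible q r) :
    ∃ V, IsCompetitor q r V (weakDeriv v) ∧ v =ᵐ[leb] V := by
  obtain ⟨h1, h2, h3⟩ := hv
  obtain ⟨V, hV, hvV⟩ := exists_isPrimitive_of_memH1 h1.1 h1.weakDeriv_spec.1 h1.weakDeriv_spec.2
  have h4 := (memH10_iff (hV.sub (isPrimitive_phi q r))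
    (hvV.mono fun x hx => by simp only [hx])).1 h2
  refine ⟨V, ⟨hV, by linarith [h4.1], by linarith [h4.2], ?_⟩, hvV⟩
  refine le_of_ae_le (continuous_phi q r).continuousOn hV.continuousOn ?_
  filter_upwards [h3, hvV] with x a b
  rwa [← b]

lemma isCompetitor_of_mem_admissible {q r : ℝ} {v : ℝ → ℝ} (hc : ContinuousOn v (Icc (-1) 1))
    (hv : v ∈ Admissible q r) : IsCompetitor q r v (weakDeriv v) := by
  obtain ⟨V, hV, h⟩ := exists_isCompetitor_of_mem_admissible hv
  exact hV.congr (eqOn_of_ae_eq hc hV.prim.continuousOn h)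

lemma J_eq {q r h : ℝ} {w v V g : ℝ → ℝ} (hV : IsPrimitive V g) (hv : v =ᵐ[leb] V) :
    J q r h w v = 1 / 2 * ∫ x, ((V x - w x) ^ 2 / h + g x ^ 2 + beta q r * V x ^ 2) ∂leb := by
  rw [J]
  congr 1
  refine integral_congr_ae ?_
  filter_upwards [hv, weakDeriv_ae_eq hV hv] with x h1 h2
  rw [h1, h2, sq_abs]

/-! ### Existence of minimizers -/

/-- The functional is, up to a constant, half the squared distance in `L²(Ω) × L²(Ω)` of
`(√λ V, V_x)`, `λ = 1 / h + β`, to a fixed point. -/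
lemma two_mul_J_eq {q r h : ℝ} (hr : 0 < r) (hh : 0 < h) {w V g : ℝ → ℝ} (hw : MemLp w 2 leb)
    (hV : IsPrimitive V g) :
    2 * J q r h w V = (∫ x, (w x / (h * √(1 / h + beta q r)) - √(1 / h + beta q r) * V x) ^ 2 ∂leb
      + ∫ x, g x ^ 2 ∂leb) + (1 / h - 1 / (h ^ 2 * (1 / h + beta q r))) * ∫ x, w x ^ 2 ∂leb := by
  have hb := beta_pos (q := q) hr
  have hl : 0 < 1 / h + beta q r := by positivity
  set l := 1 / h + beta q r with hldef
  have hs : √l ^ 2 = l := Real.sq_sqrt hl.le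
  have hs0 : 0 < √l := Real.sqrt_pos.2 hl
  have hm : MemLp (fun x => w x / (h * √l) - √l * V x) 2 leb := by
    refine MemLp.sub ?_ (hV.memLp_self.const_mul _)
    simpa only [div_eq_inv_mul] using hw.const_mul (h * √l)⁻¹
  have i1 := integrable_sq_of_memLp hm
  have i2 := integrable_sq_of_memLp hV.memLp
  have i3 := (integrable_sq_of_memLp hw).const_mul (1 / h - 1 / (h ^ 2 * l))
  have e0 := integral_add (i1.add i2) i3
  simp only [Pi.add_apply] at e0
  rw [J_eq hV (ae_eq_refl V), ← integral_add i1 i2, ← integral_const_mul (1 / h - _), ← e0,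
    ← mul_assoc, show (2 : ℝ) * (1 / 2) = 1 by norm_num, one_mul]
  refine integral_congr_ae (Filter.Eventually.of_forall fun x => ?_)
  have e1 : (w x / (h * √l) - √l * V x) ^ 2
      = w x ^ 2 / (h ^ 2 * l) - 2 * w x * V x / h + l * V x ^ 2 := by
    have : (w x / (h * √l) - √l * V x) ^ 2
      = w x ^ 2 / (h ^ 2 * √l ^ 2) - 2 * w x * V x / h + √l ^ 2 * V x ^ 2 := by
      field_simp
      ring
    rw [this, hs]
  beta_reduce
  rw [e1]
  have e2 : l * V x ^ 2 = V x ^ 2 / h + beta q r * V x ^ 2 := by rw [hldef]; ring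
  rw [e2]
  ring

/-- The points `(c V, V_x)` of `L²(Ω) × L²(Ω)`, for the admissible `V`. -/
def competitorSet (q r c : ℝ) : Set (WithLp 2 (Lp ℝ 2 leb × Lp ℝ 2 leb)) :=
  {x | ∃ V g, IsCompetitor q r V g ∧ x.fst =ᵐ[leb] (fun t => c * V t) ∧ x.snd =ᵐ[leb] g}

lemma convex_competitorSet (q r c : ℝ) : Convex ℝ (competitorSet q r c) := by
  rintro x ⟨V, g, hV, h1, h2⟩ y ⟨W, f, hW, h3, h4⟩ a b ha hb hab
  refine ⟨fun t => a * V t + b * W t, fun t => a * g t + b * f t,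
    ⟨(hV.prim.const_mul a).add (hW.prim.const_mul b), ?_, ?_, fun t ht => ?_⟩, ?_, ?_⟩
  · rw [hV.left, hW.left, ← add_mul, hab, one_mul]
  · rw [hV.right, hW.right, ← add_mul, hab, one_mul]
  · have e : phi q r t = a * phi q r t + b * phi q r t := by rw [← add_mul, hab, one_mul]
    rw [e]
    have := hV.phi_le t ht
    have := hW.phi_le t ht
    gcongr
  · rw [WithLp.add_fst, WithLp.smul_fst, WithLp.smul_fst]
    filter_upwards [h1, h3, Lp.coeFn_add (a • x.fst) (b • y.fst), Lp.coeFn_smul a x.fst,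
      Lp.coeFn_smul b y.fst] with t e1 e2 e3 e4 e5
    rw [e3, Pi.add_apply, e4, e5, Pi.smul_apply, Pi.smul_apply, e1, e2, smul_eq_mul, smul_eq_mul]
    ring
  · rw [WithLp.add_snd, WithLp.smul_snd, WithLp.smul_snd]
    filter_upwards [h2, h4, Lp.coeFn_add (a • x.snd) (b • y.snd), Lp.coeFn_smul a x.snd,
      Lp.coeFn_smul b y.snd] with t e1 e2 e3 e4 e5
    rw [e3, Pi.add_apply, e4, e5, Pi.smul_apply, Pi.smul_apply, e1, e2, smul_eq_mul, smul_eq_mul]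

/-- Convergence of the derivatives in `L²(Ω)` makes the primitives converge pointwise. -/
lemma isClosed_competitorSet (q r c : ℝ) : IsClosed (competitorSet q r c) := by
  refine isClosed_of_closure_subset fun x hx => ?_
  obtain ⟨y, hy, hyx⟩ := mem_closure_iff_seq_limit.1 hx
  choose V g hV h1 h2 using hy
  have hyx1 : Filter.Tendsto (fun n => (y n).fst) Filter.atTop (nhds x.fst) :=
    ((WithLp.continuous_fst 2 _ _).tendsto x).comp hyx
  have hyx2 : Filter.Tendsto (fun n => (y n).snd) Filter.atTop (nhds x.snd) :=
    ((WithLp.continuous_snd 2 _ _).tendsto x).comp hyx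
  have hG := Lp.memLp x.snd
  have hW : IsPrimitive (fun t => phi q r (-1) + ∫ s in (-1 : ℝ)..t, x.snd s) x.snd :=
    ⟨hG, fun t _ => by simp⟩
  set W : ℝ → ℝ := fun t => phi q r (-1) + ∫ s in (-1 : ℝ)..t, x.snd s with hWdef
  have hnorm : Filter.Tendsto (fun n => 2 * L2Norm (fun s => g n s - x.snd s)) Filter.atTop
      (nhds 0) := by
    have h3 := ((tendsto_iff_norm_sub_tendsto_zero.1 hyx2).const_mul 2)
    rw [mul_zero] at h3
    refine h3.congr fun n => ?_
    congr 1
    rw [Lp.norm_def, L2Norm]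
    congr 1
    refine eLpNorm_congr_ae ?_
    filter_upwards [Lp.coeFn_sub (y n).snd x.snd, h2 n] with t e1 e2
    rw [e1, Pi.sub_apply, e2]
  have hlim : ∀ t ∈ Icc (-1 : ℝ) 1, Filter.Tendsto (fun n => V n t) Filter.atTop
      (nhds (W t)) := by
    intro t ht
    rw [tendsto_iff_norm_sub_tendsto_zero]
    refine squeeze_zero (fun _ => norm_nonneg _) (fun n => ?_) hnorm
    have hp := (hV n).prim.sub hW
    have h3 := hp.eq_integral t ht
    have h4 : W (-1) = phi q r (-1) := by simp [hWdef]
    rw [(hV n).left, h4, sub_self, zero_add] at h3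
    rw [h3, Real.norm_eq_abs]
    refine (intervalIntegral.abs_integral_le_integral_abs ht.1).trans
      (le_trans ?_ (integral_abs_le hp.memLp))
    rw [integral_leb]
    exact intervalIntegral.integral_mono_interval le_rfl ht.1 ht.2
      (Filter.Eventually.of_forall fun _ => abs_nonneg _) hp.intervalIntegrable.abs
  refine ⟨W, x.snd, ⟨hW, by simp [hWdef], ?_, fun t ht => ?_⟩, ?_, ae_eq_refl _⟩
  · refine tendsto_nhds_unique (hlim 1 (by simp)) ?_
    simp only [fun n => (hV n).right]
    exact tendsto_const_nhds
  · exact ge_of_tendsto' (hlim t ht) fun n => (hV n).phi_le t ht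
  · obtain ⟨ns, hns, hae⟩ := (tendstoInMeasure_of_tendsto_Lp hyx1).exists_seq_tendsto_ae
    filter_upwards [hae, ae_all_iff.2 h1,
      ae_leb_of_forall (p := fun x => x ∈ Ioo (-1 : ℝ) 1) fun _ h => h] with t e1 e2 ht
    refine tendsto_nhds_unique e1 ?_
    simp only [e2]
    exact ((hlim t (Ioo_subset_Icc_self ht)).comp hns.tendsto_atTop).const_mul c

lemma norm_toLp_sub_sq {f : ℝ → ℝ} (hf : MemLp f 2 leb) {F : Lp ℝ 2 leb} {k : ℝ → ℝ}
    (hk : MemLp k 2 leb) (hFk : F =ᵐ[leb] k) :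
    ‖hf.toLp f - F‖ ^ 2 = ∫ x, (f x - k x) ^ 2 ∂leb := by
  rw [L2Norm_toLp_sub, L2Norm_congr (g := fun x => f x - k x)
    (hFk.mono fun x hx => by simp only [hx])]
  exact L2Norm_sq (hf.sub hk)

/-- The functional `J` attains its minimum over the admissible functions: the minimizer is given by
the projection onto a closed convex subset of a Hilbert space. -/
lemma exists_minimizer {q r h : ℝ} (hr : 0 < r) (hh : 0 < h) {w : ℝ → ℝ} (hw : MemLp w 2 leb) :
    ∃ V g, IsCompetitor q r V g ∧ ∀ v ∈ Admissible q r, J q r h w V ≤ J q r h w v := by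
  set c := √(1 / h + beta q r) with hc
  have hm : MemLp (fun x => w x / (h * c)) 2 leb := by
    simpa only [div_eq_inv_mul] using hw.const_mul (h * c)⁻¹
  have hz : MemLp (fun _ : ℝ => (0 : ℝ)) 2 leb := memLp_const 0
  let p : WithLp 2 (Lp ℝ 2 leb × Lp ℝ 2 leb) := WithLp.toLp 2 (hm.toLp _, hz.toLp _)
  have hmk : ∀ V g, IsCompetitor q r V g → ∃ x ∈ competitorSet q r c,
      x.fst =ᵐ[leb] (fun t => c * V t) ∧ x.snd =ᵐ[leb] g := by
    intro V g hV
    have a1 := (hV.prim.memLp_self.const_mul c).coeFn_toLp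
    have a2 := hV.prim.memLp.coeFn_toLp
    exact ⟨WithLp.toLp 2 ((hV.prim.memLp_self.const_mul c).toLp _, hV.prim.memLp.toLp _),
      ⟨V, g, hV, a1, a2⟩, a1, a2⟩
  have hdist : ∀ (x : WithLp 2 (Lp ℝ 2 leb × Lp ℝ 2 leb)) V g, IsCompetitor q r V g →
      x.fst =ᵐ[leb] (fun t => c * V t) → x.snd =ᵐ[leb] g →
      2 * J q r h w V = ‖p - x‖ ^ 2
        + (1 / h - 1 / (h ^ 2 * (1 / h + beta q r))) * ∫ x, w x ^ 2 ∂leb := by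
    intro x V g hV h1 h2
    rw [two_mul_J_eq hr hh hw hV.prim, WithLp.prod_norm_sq_eq_of_L2, WithLp.sub_fst,
      WithLp.sub_snd]
    have e1 := norm_toLp_sub_sq hm (hV.prim.memLp_self.const_mul c) h1
    have e2 := norm_toLp_sub_sq hz hV.prim.memLp h2
    simp only [zero_sub, neg_sq] at e2
    rw [← e1, ← e2]
    rfl
  obtain ⟨x₀, hx₀, -⟩ := hmk _ _ (isCompetitor_phi q r)
  obtain ⟨x, ⟨V, g, hV, h1, h2⟩, hmin⟩ := exists_norm_eq_iInf_of_complete_convex ⟨x₀, hx₀⟩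
    (isClosed_competitorSet q r c).isComplete (convex_competitorSet q r c) p
  refine ⟨V, g, hV, fun v hv => ?_⟩
  obtain ⟨W, hW, hvW⟩ := exists_isCompetitor_of_mem_admissible hv
  obtain ⟨y, hy, h3, h4⟩ := hmk _ _ hW
  have e1 := hdist x V g hV h1 h2
  have e2 := hdist y W _ hW h3 h4
  have e3 : J q r h w v = J q r h w W := by
    rw [J_eq hW.prim hvW, J_eq hW.prim (ae_eq_refl W)]
  have e4 : ‖p - x‖ ≤ ‖p - y‖ := by
    rw [hmin]
    exact ciInf_le ⟨0, forall_mem_range.2 fun _ => norm_nonneg _⟩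
      (⟨y, hy⟩ : competitorSet q r c)
  have e5 : ‖p - x‖ ^ 2 ≤ ‖p - y‖ ^ 2 := by gcongr
  linarith

/-! ### Iterated primitives and convexity -/

/-- The primitive of `k` that vanishes at `-1`. -/
def primitive (k : ℝ → ℝ) (x : ℝ) : ℝ := ∫ t in (-1 : ℝ)..x, k t

lemma hasDerivAt_primitive {k : ℝ → ℝ} (hk : Continuous k) (x : ℝ) :
    HasDerivAt (primitive k) (k x) x := (hk.integral_hasStrictDerivAt (-1) x).hasDerivAt

lemma continuous_primitive {k : ℝ → ℝ} (hk : Continuous k) : Continuous (primitive k) :=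
  continuous_iff_continuousAt.2 fun x => (hasDerivAt_primitive hk x).continuousAt

lemma deriv_primitive {k : ℝ → ℝ} (hk : Continuous k) : deriv (primitive k) = k :=
  funext fun x => (hasDerivAt_primitive hk x).deriv

lemma contDiff_one_primitive {k : ℝ → ℝ} (hk : Continuous k) : ContDiff ℝ 1 (primitive k) := by
  rw [contDiff_one_iff_deriv, deriv_primitive hk]
  exact ⟨fun x => (hasDerivAt_primitive hk x).differentiableAt, hk⟩

lemma contDiff_two_primitive_primitive {k : ℝ → ℝ} (hk : Continuous k) :
    ContDiff ℝ 2 (primitive (primitive k)) := by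
  rw [show (2 : WithTop ℕ∞) = 1 + 1 by norm_num, contDiff_succ_iff_deriv,
    deriv_primitive (continuous_primitive hk)]
  exact ⟨fun x => (hasDerivAt_primitive (continuous_primitive hk) x).differentiableAt, by simp,
    contDiff_one_primitive hk⟩

lemma convexOn_add_primitive_primitive {D : Set ℝ} (hD : Convex ℝ D) {f f' f'' m : ℝ → ℝ}
    (hf : ∀ x, HasDerivAt f (f' x) x) (hf' : ∀ x, HasDerivAt f' (f'' x) x) (hm : Continuous m)
    (h0 : ∀ x ∈ D, 0 ≤ f'' x + m x) :
    ConvexOn ℝ D (fun x => f x + primitive (primitive m) x) := by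
  have d1 : ∀ x, HasDerivAt (fun x => f x + primitive (primitive m) x) (f' x + primitive m x) x :=
    fun x => (hf x).add (hasDerivAt_primitive (continuous_primitive hm) x)
  have d2 : ∀ x, HasDerivAt (fun x => f' x + primitive m x) (f'' x + m x) x :=
    fun x => (hf' x).add (hasDerivAt_primitive hm x)
  exact convexOn_of_hasDerivWithinAt2_nonneg hD
    (fun x _ => (d1 x).continuousAt.continuousWithinAt) (fun x _ => (d1 x).hasDerivWithinAt)
    (fun x _ => (d2 x).hasDerivWithinAt) fun x hx => h0 x (interior_subset hx)

/-- A continuous function is convex if it is midpoint convex on sufficiently short intervals around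
each point. -/
lemma convexOn_of_local_midpoint {f : ℝ → ℝ} {a b : ℝ} (hf : ContinuousOn f (Icc a b))
    (h : ∀ x ∈ Ioo a b, ∃ ε > 0, ∀ s ∈ Ioo 0 ε, 2 * f x ≤ f (x - s) + f (x + s)) :
    ConvexOn ℝ (Icc a b) f := by
  refine convexOn_of_slope_mono_adjacent (convex_Icc a b) fun {x y z} hx hz hxy hyz => ?_
  by_contra! hlt
  have hxz : x < z := hxy.trans hyz
  set σ := (f z - f x) / (z - x) with hσ
  have hσ' : σ * (z - x) = f z - f x := div_mul_cancel₀ _ (by linarith)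
  set G : ℝ → ℝ := fun t => f t - (f x + σ * (t - x)) with hG
  have hGc : ContinuousOn G (Icc x z) :=
    (hf.mono (Icc_subset_Icc hx.1 hz.2)).sub (by fun_prop)
  have hGx : G x = 0 := by simp [hG]
  have hGz : G z = 0 := by simp only [hG]; linarith
  have hGy : 0 < G y := by
    rw [div_lt_div_iff₀ (by linarith) (by linarith)] at hlt
    have h1 : (f y - f x) * (z - x) > (f z - f x) * (y - x) := by nlinarith
    rw [← hσ'] at h1
    have h2 : (f y - f x - σ * (y - x)) * (z - x) > 0 := by nlinarith
    have h3 := pos_of_mul_pos_left h2 (by linarith)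
    simp only [hG]; linarith
  obtain ⟨t₀, ht₀, hmax⟩ := isCompact_Icc.exists_isMaxOn (nonempty_Icc.2 hxz.le) hGc
  have hM : 0 < G t₀ := hGy.trans_le (hmax ⟨hxy.le, hyz.le⟩)
  -- At the leftmost maximum point the midpoint inequality fails.
  have hS : IsCompact (Icc x z ∩ G ⁻¹' {G t₀}) :=
    isCompact_Icc.of_isClosed_subset
      (hGc.preimage_isClosed_of_isClosed isClosed_Icc isClosed_singleton) inter_subset_left
  obtain ⟨t₁, ⟨ht₁, ht₁M⟩, hleast⟩ := hS.exists_isLeast ⟨t₀, ht₀, rfl⟩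
  have hM₁ : G t₁ = G t₀ := ht₁M
  have hx₁ : x < t₁ := lt_of_le_of_ne ht₁.1 fun e => by rw [← e, hGx] at hM₁; linarith
  have hz₁ : t₁ < z := lt_of_le_of_ne ht₁.2 fun e => by rw [e, hGz] at hM₁; linarith
  obtain ⟨ε, hε, hmid⟩ := h t₁ ⟨hx.1.trans_lt hx₁, hz₁.trans_le hz.2⟩
  obtain ⟨s, hs0, hs⟩ := exists_between
    (lt_min hε (lt_min (sub_pos.2 hx₁) (sub_pos.2 hz₁)))
  rw [lt_min_iff, lt_min_iff] at hs
  have m1 : t₁ - s ∈ Icc x z := ⟨by linarith, by linarith⟩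
  have m2 : t₁ + s ∈ Icc x z := ⟨by linarith, by linarith⟩
  have h1 : G (t₁ - s) < G t₀ := lt_of_le_of_ne (hmax m1) fun e => by
    have := hleast ⟨m1, e⟩
    linarith
  have h2 : G (t₁ + s) ≤ G t₀ := hmax m2
  have h3 := hmid s ⟨hs0, hs.1⟩
  simp only [hG] at h1 h2 hM₁
  nlinarith

/-- If the sum of two convex functions is differentiable at an interior point, then so are the
summands. -/
lemma exists_hasDerivAt_of_convexOn_add {D : Set ℝ} {f g : ℝ → ℝ} {S x : ℝ}
    (hf : ConvexOn ℝ D f) (hg : ConvexOn ℝ D g) (hx : x ∈ interior D)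
    (h : HasDerivAt (fun y => f y + g y) S x) : ∃ f', HasDerivAt f f' x := by
  have fr := hf.hasDerivWithinAt_rightDeriv_of_mem_interior hx
  have fl := hf.hasDerivWithinAt_leftDeriv_of_mem_interior hx
  have gr := hg.hasDerivWithinAt_rightDeriv_of_mem_interior hx
  have gl := hg.hasDerivWithinAt_leftDeriv_of_mem_interior hx
  have f1 := hf.leftDeriv_le_rightDeriv_of_mem_interior hx
  have g1 := hg.leftDeriv_le_rightDeriv_of_mem_interior hx
  have e1 := (uniqueDiffWithinAt_Ioi x).eq_deriv _ (fr.add gr) h.hasDerivWithinAt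
  have e2 := (uniqueDiffWithinAt_Iio x).eq_deriv _ (fl.add gl) h.hasDerivWithinAt
  have e3 : derivWithin f (Iio x) x = derivWithin f (Ioi x) x := by linarith
  refine ⟨derivWithin f (Ioi x) x, ?_⟩
  rw [e3, hasDerivWithinAt_Iio_iff_Iic] at fl
  rw [hasDerivWithinAt_Ioi_iff_Ici] at fr
  have h2 := fl.union fr
  rwa [Iic_union_Ici, hasDerivWithinAt_univ] at h2

lemma nonpos_of_hasDerivAt_of_antitoneOn {f : ℝ → ℝ} {s : Set ℝ} {x f' : ℝ} (hs : IsOpen s)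
    (hx : x ∈ s) (hf : AntitoneOn f s) (h : HasDerivAt f f' x) : f' ≤ 0 := by
  have h1 := hf.derivWithin_nonpos (x := x)
  rwa [h.hasDerivWithinAt.derivWithin (hs.uniqueDiffWithinAt hx)] at h1

lemma nonneg_of_hasDerivAt_of_monotoneOn {f : ℝ → ℝ} {s : Set ℝ} {x f' : ℝ} (hs : IsOpen s)
    (hx : x ∈ s) (hf : MonotoneOn f s) (h : HasDerivAt f f' x) : 0 ≤ f' := by
  have h1 := hf.derivWithin_nonneg (x := x)
  rwa [h.hasDerivWithinAt.derivWithin (hs.uniqueDiffWithinAt hx)] at h1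

lemma abs_primitive_sub_le {k : ℝ → ℝ} (hk : Continuous k) {C : ℝ}
    (hC : ∀ x ∈ Icc (-1 : ℝ) 1, |k x| ≤ C) {x y : ℝ} (hx : x ∈ Icc (-1 : ℝ) 1)
    (hy : y ∈ Icc (-1 : ℝ) 1) (hxy : x ≤ y) :
    |primitive k y - primitive k x| ≤ C * (y - x) := by
  have h := Convex.norm_image_sub_le_of_norm_hasDerivWithin_le
    (f := primitive k) (f' := k) (s := Icc (-1) 1) (C := C)
    (fun t _ => (hasDerivAt_primitive hk t).hasDerivWithinAt) hC (convex_Icc _ _) hx hy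
  simpa [Real.norm_eq_abs, abs_of_nonneg (sub_nonneg.2 hxy)] using h

lemma isPrimitive_deriv_of_lipschitzWith {f : ℝ → ℝ} {K : NNReal} (hf : LipschitzWith K f) :
    IsPrimitive f (deriv f) := by
  refine ⟨MemLp.of_bound (measurable_deriv f).aestronglyMeasurable K
    (Filter.Eventually.of_forall fun x => norm_deriv_le_of_lipschitz hf), fun x hx => ?_⟩
  have h := (hf.lipschitzOnWith (s := uIcc (-1) x)).absolutelyContinuousOnInterval
  rw [h.integral_deriv_eq_sub]
  ring

/-! ### Regularity in the obstacle problem -/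

/-- The regularity of `u`, if `u - K` is concave and is affine off the contact set, where
`K_xx = k`. As `u` lies above the semiconvex obstacle and touches it on the contact set, `u` is also
semiconvex; therefore its derivative is Lipschitz continuous. -/
lemma exists_second_derivative {u φ k m : ℝ → ℝ} (hu : ContinuousOn u (Icc (-1) 1))
    (hk : Continuous k) (hm : Continuous m) (hkm : ∀ x, -k x ≤ m x)
    (hφu : ∀ x ∈ Icc (-1 : ℝ) 1, φ x ≤ u x)
    (hφm : ConvexOn ℝ (Icc (-1) 1) (fun x => φ x + primitive (primitive m) x))
    (hconc : ConcaveOn ℝ (Icc (-1) 1) (fun x => u x - primitive (primitive k) x))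
    (hconv : ∀ x ∈ Ioo (-1 : ℝ) 1, φ x < u x → ∃ ε > 0, Ioo (x - ε) (x + ε) ⊆ Ioo (-1) 1 ∧
      ConvexOn ℝ (Ioo (x - ε) (x + ε)) (fun x => u x - primitive (primitive k) x)) :
    ∃ U₁ U₂, IsPrimitive u U₁ ∧ IsPrimitive U₁ U₂ ∧
      ∀ᵐ x ∂leb, U₂ x ≤ k x ∧ -m x ≤ U₂ x ∧ (φ x < u x → U₂ x = k x) := by
  have hM := continuous_primitive (continuous_primitive hm)
  have mid : ∀ {D : Set ℝ} {f : ℝ → ℝ}, ConvexOn ℝ D f → ∀ {x s : ℝ}, x - s ∈ D → x + s ∈ D →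
      2 * f x ≤ f (x - s) + f (x + s) := by
    intro D f hf x s h1 h2
    have h3 := hf.2 h1 h2 (show (0 : ℝ) ≤ 1 / 2 by norm_num) (show (0 : ℝ) ≤ 1 / 2 by norm_num)
      (by norm_num)
    simp only [smul_eq_mul] at h3
    rw [show 1 / 2 * (x - s) + 1 / 2 * (x + s) = x by ring] at h3
    linarith
  have hF : ConvexOn ℝ (Icc (-1) 1) (fun x => u x + primitive (primitive m) x) := by
    refine convexOn_of_local_midpoint (hu.add hM.continuousOn) fun x hx => ?_
    rcases (hφu x (Ioo_subset_Icc_self hx)).eq_or_lt with heq | hlt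
    -- At a contact point the inequality is inherited from the obstacle, which lies below `u`.
    · refine ⟨min (1 + x) (1 - x), lt_min (by linarith [hx.1]) (by linarith [hx.2]),
        fun s hs => ?_⟩
      have hs1 : s < 1 + x := hs.2.trans_le (min_le_left _ _)
      have hs2 : s < 1 - x := hs.2.trans_le (min_le_right _ _)
      have m1 : x - s ∈ Icc (-1 : ℝ) 1 := ⟨by linarith, by linarith [hs.1, hx.2]⟩
      have m2 : x + s ∈ Icc (-1 : ℝ) 1 := ⟨by linarith [hs.1, hx.1], by linarith⟩
      have h1 := mid hφm m1 m2
      have h2 := hφu _ m1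
      have h3 := hφu _ m2
      linarith
    · obtain ⟨ε, hε, -, hc⟩ := hconv x hx hlt
      refine ⟨ε, hε, fun s hs => ?_⟩
      have m1 : x - s ∈ Ioo (x - ε) (x + ε) := ⟨by linarith [hs.2], by linarith [hs.1]⟩
      have m2 : x + s ∈ Ioo (x - ε) (x + ε) := ⟨by linarith [hs.1], by linarith [hs.2]⟩
      have h1 := mid hc m1 m2
      have h2 := mid (convexOn_add_primitive_primitive convex_univ
        (hasDerivAt_primitive (continuous_primitive hk)) (hasDerivAt_primitive hk) hm
        fun y _ => by linarith [hkm y]) (mem_univ (x - s)) (mem_univ (x + s))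
      linarith
  -- The derivative of `u` exists, since `u` is semiconvex and semiconcave.
  have hd : ∀ x ∈ Ioo (-1 : ℝ) 1, HasDerivAt u (deriv u x) x := by
    intro x hx
    have hM' := hasDerivAt_primitive (continuous_primitive hm) x
    have hK' := hasDerivAt_primitive (continuous_primitive hk) x
    obtain ⟨F', hF'⟩ := exists_hasDerivAt_of_convexOn_add hF hconc.neg (x := x)
      (by rwa [interior_Icc]) ((hM'.add hK').congr_of_eventuallyEq
        (Filter.Eventually.of_forall fun y => by simp only [Pi.neg_apply, Pi.add_apply]; ring))
    have h2 : HasDerivAt u (F' - primitive m x) x :=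
      (hF'.sub hM').congr_of_eventuallyEq
        (Filter.Eventually.of_forall fun y => by simp only [Pi.sub_apply]; ring)
    exact h2.differentiableAt.hasDerivAt
  have hdF : ∀ x ∈ Ioo (-1 : ℝ) 1, HasDerivAt (fun x => u x + primitive (primitive m) x)
      (deriv u x + primitive m x) x := fun x hx =>
    (hd x hx).add (hasDerivAt_primitive (continuous_primitive hm) x)
  have hdP : ∀ x ∈ Ioo (-1 : ℝ) 1, HasDerivAt (fun x => u x - primitive (primitive k) x)
      (deriv u x - primitive k x) x := fun x hx =>
    (hd x hx).sub (hasDerivAt_primitive (continuous_primitive hk) x)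
  have hmono : MonotoneOn (fun x => deriv u x + primitive m x) (Ioo (-1) 1) :=
    ((hF.subset Ioo_subset_Icc_self (convex_Ioo _ _)).monotoneOn_deriv
      fun x hx => (hdF x hx).differentiableAt).congr fun x hx => (hdF x hx).deriv
  have hanti : AntitoneOn (fun x => deriv u x - primitive k x) (Ioo (-1) 1) :=
    ((hconc.subset Ioo_subset_Icc_self (convex_Ioo _ _)).antitoneOn_deriv
      fun x hx => (hdP x hx).differentiableAt).congr fun x hx => (hdP x hx).deriv
  obtain ⟨C₁, hC₁⟩ := isCompact_Icc.exists_bound_of_continuousOn (s := Icc (-1 : ℝ) 1)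
    hk.continuousOn
  obtain ⟨C₂, hC₂⟩ := isCompact_Icc.exists_bound_of_continuousOn (s := Icc (-1 : ℝ) 1)
    hm.continuousOn
  have hlip : LipschitzOnWith (Real.toNNReal (max C₁ C₂)) (deriv u) (Ioo (-1) 1) := by
    have hle : ∀ x ∈ Ioo (-1 : ℝ) 1, ∀ y ∈ Ioo (-1 : ℝ) 1, x ≤ y →
        |deriv u y - deriv u x| ≤ Real.toNNReal (max C₁ C₂) * (y - x) := by
      intro x hx y hy hxy
      have hx' := Ioo_subset_Icc_self hx
      have hy' := Ioo_subset_Icc_self hy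
      have b1 := abs_le.1 (abs_primitive_sub_le hk hC₁ hx' hy' hxy)
      have b2 := abs_le.1 (abs_primitive_sub_le hm hC₂ hx' hy' hxy)
      have b3 := hmono hx hy hxy
      have b4 := hanti hx hy hxy
      simp only at b3 b4
      have b5 : max C₁ C₂ * (y - x) ≤ Real.toNNReal (max C₁ C₂) * (y - x) :=
        mul_le_mul_of_nonneg_right (Real.le_coe_toNNReal _) (by linarith)
      have b6 : C₁ * (y - x) ≤ max C₁ C₂ * (y - x) :=
        mul_le_mul_of_nonneg_right (le_max_left _ _) (by linarith)
      have b7 : C₂ * (y - x) ≤ max C₁ C₂ * (y - x) :=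
        mul_le_mul_of_nonneg_right (le_max_right _ _) (by linarith)
      rw [abs_le]
      constructor <;> linarith
    refine lipschitzOnWith_iff_norm_sub_le.2 fun x hx y hy => ?_
    rw [Real.norm_eq_abs, Real.norm_eq_abs]
    rcases le_total x y with hxy | hxy
    · rw [abs_sub_comm, abs_sub_comm x y, abs_of_nonneg (sub_nonneg.2 hxy)]
      exact hle x hx y hy hxy
    · rw [abs_of_nonneg (sub_nonneg.2 hxy)]
      exact hle y hy x hx hxy
  obtain ⟨U₁, hU₁, hEq⟩ := hlip.extend_real
  refine ⟨U₁, deriv U₁, IsPrimitive.of_continuousOn_of_hasDerivAt hu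
    (memLp_of_continuousOn hU₁.continuous.continuousOn) fun x hx => hEq hx ▸ hd x hx,
    isPrimitive_deriv_of_lipschitzWith hU₁, ae_leb_iff.2 ?_⟩
  filter_upwards [hU₁.ae_differentiableAt_real] with x hxd hx
  have hx1 := hxd.hasDerivAt
  have hKx := hasDerivAt_primitive hk x
  have hMx := hasDerivAt_primitive hm x
  refine ⟨?_, ?_, fun hlt => ?_⟩
  · have := nonpos_of_hasDerivAt_of_antitoneOn isOpen_Ioo hx
      (hanti.congr fun y hy => by simp only [hEq hy, Pi.sub_apply]) (hx1.sub hKx)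
    linarith
  · have := nonneg_of_hasDerivAt_of_monotoneOn isOpen_Ioo hx
      (hmono.congr fun y hy => by simp only [hEq hy, Pi.add_apply]) (hx1.add hMx)
    linarith
  · obtain ⟨ε, hε, hsub, hc⟩ := hconv x hx hlt
    have h1 := nonpos_of_hasDerivAt_of_antitoneOn isOpen_Ioo hx
      (hanti.congr fun y hy => by simp only [hEq hy, Pi.sub_apply]) (hx1.sub hKx)
    have hmono' : MonotoneOn (fun x => deriv u x - primitive k x) (Ioo (x - ε) (x + ε)) :=
      (hc.monotoneOn_deriv fun y hy => (hdP y (hsub hy)).differentiableAt).congr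
        fun y hy => (hdP y (hsub hy)).deriv
    have h2 := nonneg_of_hasDerivAt_of_monotoneOn isOpen_Ioo
      (show x ∈ Ioo (x - ε) (x + ε) from ⟨by linarith, by linarith⟩)
      (hmono'.congr fun y hy => by simp only [hEq (hsub hy), Pi.sub_apply]) (hx1.sub hKx)
    linarith

/-! ### The first variation and piecewise linear test functions -/

lemma first_variation_nonneg {q r h : ℝ} {w u g η e : ℝ → ℝ} (hw : MemLp w 2 leb)
    (hu : IsPrimitive u g) (hmin : ∀ v ∈ Admissible q r, J q r h w u ≤ J q r h w v)
    (hη : IsPrimitive η e) {t₀ : ℝ} (ht₀ : 0 < t₀)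
    (hadm : ∀ t ∈ Ioo 0 t₀, (fun x => u x + t * η x) ∈ Admissible q r) :
    0 ≤ ∫ x, g x * e x ∂leb + ∫ x, ((u x - w x) / h + beta q r * u x) * η x ∂leb := by
  have hm1 : MemLp (fun x => u x - w x) 2 leb := hu.memLp_self.sub hw
  have hm2 : MemLp (fun x => (u x - w x) / h + beta q r * u x) 2 leb := by
    refine MemLp.add ?_ (hu.memLp_self.const_mul _)
    simpa only [div_eq_inv_mul] using hm1.const_mul h⁻¹
  have i1 := integrable_mul_of_memLp hu.memLp hη.memLp
  have i2 := integrable_mul_of_memLp hm2 hη.memLp_self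
  have i3 : Integrable (fun x => (u x - w x) ^ 2 / h + g x ^ 2 + beta q r * u x ^ 2) leb :=
    (((integrable_sq_of_memLp hm1).div_const h).add (integrable_sq_of_memLp hu.memLp)).add
      ((integrable_sq_of_memLp hu.memLp_self).const_mul _)
  have i4 : Integrable (fun x => η x ^ 2 / h + e x ^ 2 + beta q r * η x ^ 2) leb :=
    (((integrable_sq_of_memLp hη.memLp_self).div_const h).add (integrable_sq_of_memLp hη.memLp)).add
      ((integrable_sq_of_memLp hη.memLp_self).const_mul _)
  have i5 : Integrable
      (fun x => g x * e x + ((u x - w x) / h + beta q r * u x) * η x) leb := i1.add i2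
  have i6 (t : ℝ) : Integrable (fun x =>
      2 * t * (g x * e x + ((u x - w x) / h + beta q r * u x) * η x)
        + t ^ 2 * (η x ^ 2 / h + e x ^ 2 + beta q r * η x ^ 2)) leb :=
    (i5.const_mul _).add (i4.const_mul _)
  set A := ∫ x, g x * e x ∂leb + ∫ x, ((u x - w x) / h + beta q r * u x) * η x ∂leb with hA
  set B := ∫ x, (η x ^ 2 / h + e x ^ 2 + beta q r * η x ^ 2) ∂leb with hB
  have key : ∀ t ∈ Ioo 0 t₀, 0 ≤ 2 * A + t * B := by
    intro t ht
    have h1 := hmin _ (hadm t ht)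
    rw [J_eq hu (ae_eq_refl u), J_eq (hu.add (hη.const_mul t)) (ae_eq_refl _)] at h1
    have h2 : ∫ x, ((u x + t * η x - w x) ^ 2 / h + (g x + t * e x) ^ 2
        + beta q r * (u x + t * η x) ^ 2) ∂leb
        = ∫ x, ((u x - w x) ^ 2 / h + g x ^ 2 + beta q r * u x ^ 2) ∂leb
          + (2 * t * A + t ^ 2 * B) := by
      rw [hA, hB, ← integral_add i1 i2, ← integral_const_mul, ← integral_const_mul,
        ← integral_add (i5.const_mul _) (i4.const_mul _), ← integral_add i3 (i6 t)]
      refine integral_congr_ae (Filter.Eventually.of_forall fun x => ?_)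
      beta_reduce
      ring
    rw [h2] at h1
    have h3 : 0 ≤ t * (2 * A + t * B) := by linarith
    exact nonneg_of_mul_nonneg_right h3 ht.1
  have hlim : Filter.Tendsto (fun t : ℝ => 2 * A + t * B) (nhdsWithin 0 (Ioi 0))
      (nhds (2 * A)) := by
    have : Filter.Tendsto (fun t : ℝ => 2 * A + t * B) (nhds 0) (nhds (2 * A + 0 * B)) :=
      Continuous.tendsto (by fun_prop) 0
    rw [zero_mul, add_zero] at this
    exact this.mono_left nhdsWithin_le_nhds
  have := ge_of_tendsto hlim (by
    filter_upwards [Ioo_mem_nhdsGT ht₀] with t ht using key t ht)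
  linarith

/-- The function that vanishes up to `a`, has slope `1` on `[a, b]`, and is constant after `b`. -/
def ramp (a b x : ℝ) : ℝ := max 0 (min x b - a)

lemma isPrimitive_ramp {a b : ℝ} (ha : -1 ≤ a) :
    IsPrimitive (ramp a b) (indicator (Ioc a b) 1) := by
  refine ⟨(memLp_const (1 : ℝ)).indicator measurableSet_Ioc, fun x hx => ?_⟩
  rw [intervalIntegral.integral_of_le hx.1, setIntegral_indicator measurableSet_Ioc,
    Ioc_inter_Ioc, sup_eq_right.2 ha]
  have h1 : ramp a b (-1) = 0 := by
    rw [ramp, max_eq_left]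
    linarith [min_le_left (-1) b]
  simp only [Pi.one_apply, setIntegral_const, Real.volume_real_Ioc, smul_eq_mul, mul_one, h1,
    zero_add]
  rw [ramp, max_comm]

lemma integral_mul_indicator_Ioc {Q : ℝ → ℝ} {a b : ℝ} (ha : -1 ≤ a) (hab : a ≤ b)
    (hb : b ≤ 1) : ∫ x, Q x * indicator (Ioc a b) 1 x ∂leb = ∫ x in a..b, Q x := by
  have h1 : ∀ x, Q x * indicator (Ioc a b) 1 x = indicator (Ioc a b) Q x := fun x => by
    by_cases hx : x ∈ Ioc a b <;> simp [hx]
  simp only [h1]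
  rw [integral_leb, intervalIntegral.integral_of_le (by norm_num),
    setIntegral_indicator measurableSet_Ioc, Ioc_inter_Ioc, sup_eq_right.2 ha, inf_eq_right.2 hb,
    intervalIntegral.integral_of_le hab]

/-- The piecewise linear function with the value `1` at `b` that vanishes outside `[a, c]`. -/
def hat (a b c x : ℝ) : ℝ := 1 / (b - a) * ramp a b x - 1 / (c - b) * ramp b c x

/-- The derivative of `hat a b c`. -/
def hatDeriv (a b c x : ℝ) : ℝ :=
  1 / (b - a) * indicator (Ioc a b) 1 x - 1 / (c - b) * indicator (Ioc b c) 1 x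

section hat

variable {a b c : ℝ}

lemma isPrimitive_hat (ha : -1 ≤ a) (hab : a < b) :
    IsPrimitive (hat a b c) (hatDeriv a b c) :=
  ((isPrimitive_ramp ha).const_mul _).sub ((isPrimitive_ramp (ha.trans hab.le)).const_mul _)

lemma hat_of_le (hab : a < b) {x : ℝ} (hx : x ≤ a) : hat a b c x = 0 := by
  have h1 : ramp a b x = 0 := max_eq_left (by linarith [min_le_left x b])
  have h2 : ramp b c x = 0 := max_eq_left (by linarith [min_le_left x c])
  rw [hat, h1, h2]; ring

lemma hat_of_ge (hab : a < b) (hbc : b < c) {x : ℝ} (hx : c ≤ x) : hat a b c x = 0 := by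
  have h1 : ramp a b x = b - a := by
    rw [ramp, min_eq_right (by linarith), max_eq_right (by linarith)]
  have h2 : ramp b c x = c - b := by
    rw [ramp, min_eq_right hx, max_eq_right (by linarith)]
  rw [hat, h1, h2, one_div_mul_cancel (by linarith), one_div_mul_cancel (by linarith), sub_self]

lemma hat_nonneg (hab : a < b) (hbc : b < c) (x : ℝ) : 0 ≤ hat a b c x := by
  have hb' : 0 < b - a := by linarith
  have hc' : 0 < c - b := by linarith
  rcases le_total x b with hx | hx
  · have h2 : ramp b c x = 0 := max_eq_left (by linarith [min_le_left x c])
    rw [hat, h2, mul_zero, sub_zero]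
    exact mul_nonneg (by positivity) (le_max_left _ _)
  · have h1 : ramp a b x = b - a := by
      rw [ramp, min_eq_right hx, max_eq_right (by linarith)]
    have h2 : ramp b c x ≤ c - b := max_le hc'.le (by linarith [min_le_right x c])
    rw [hat, h1, one_div_mul_cancel hb'.ne']
    have := mul_le_mul_of_nonneg_left h2 (show 0 ≤ 1 / (c - b) by positivity)
    rw [one_div_mul_cancel hc'.ne'] at this
    linarith

lemma hat_le_one (hab : a < b) (hbc : b < c) (x : ℝ) : hat a b c x ≤ 1 := by
  have hb' : 0 < b - a := by linarith
  have hc' : 0 < c - b := by linarith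
  have h1 : ramp a b x ≤ b - a := max_le hb'.le (by linarith [min_le_right x b])
  have h2 : 0 ≤ ramp b c x := le_max_left _ _
  have h3 := mul_le_mul_of_nonneg_left h1 (show 0 ≤ 1 / (b - a) by positivity)
  rw [one_div_mul_cancel hb'.ne'] at h3
  have h4 := mul_nonneg (show 0 ≤ 1 / (c - b) by positivity) h2
  rw [hat]; linarith

/-- On a piecewise linear test function the first variation is a difference of slopes. -/
lemma first_variation_hat {u g k : ℝ → ℝ} (hu : IsPrimitive u g) (hk : Continuous k)
    (ha : -1 ≤ a) (hab : a < b) (hbc : b < c) (hc : c ≤ 1) :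
    ∫ x, g x * hatDeriv a b c x ∂leb + ∫ x, k x * hat a b c x ∂leb
      = ((u b - primitive (primitive k) b) - (u a - primitive (primitive k) a)) / (b - a)
        - ((u c - primitive (primitive k) c) - (u b - primitive (primitive k) b)) / (c - b) := by
  have hK := continuous_primitive hk
  have hK1 : IsPrimitive (primitive k) k :=
    IsPrimitive.of_continuousOn_of_hasDerivAt hK.continuousOn
      (memLp_of_continuousOn hk.continuousOn) fun x _ => hasDerivAt_primitive hk x
  have hhat := isPrimitive_hat (c := c) ha hab
  have h1 := hK1.integral_mul_eq_neg hhat (hat_of_le hab ha) (hat_of_ge hab hbc hc)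
  have h2 : ∫ x, g x * hatDeriv a b c x ∂leb + ∫ x, k x * hat a b c x ∂leb
      = ∫ x, (g x - primitive k x) * hatDeriv a b c x ∂leb := by
    rw [← neg_eq_iff_eq_neg.2 h1, ← sub_eq_add_neg,
      ← integral_sub (integrable_mul_of_memLp hu.memLp hhat.memLp)
      (integrable_mul_of_memLp hK1.memLp_self hhat.memLp)]
    exact integral_congr_ae (Filter.Eventually.of_forall fun x => by simp only; ring)
  have hQ : MemLp (fun x => g x - primitive k x) 2 leb := hu.memLp.sub hK1.memLp_self
  have hint : ∀ {s t : ℝ}, -1 ≤ s → s ≤ t → t ≤ 1 →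
      ∫ x in s..t, (g x - primitive k x)
        = (u t - primitive (primitive k) t) - (u s - primitive (primitive k) s) := by
    intro s t hs hst ht
    have ms : s ∈ Icc (-1 : ℝ) 1 := ⟨hs, hst.trans ht⟩
    have mt : t ∈ Icc (-1 : ℝ) 1 := ⟨hs.trans hst, ht⟩
    have ig : IntervalIntegrable g volume s t :=
      (hu.intervalIntegrable_of_mem ms).symm.trans (hu.intervalIntegrable_of_mem mt)
    have e1 : ∫ x in s..t, g x = u t - u s := by
      rw [← intervalIntegral.integral_interval_sub_left (hu.intervalIntegrable_of_mem mt)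
        (hu.intervalIntegrable_of_mem ms), hu.eq_integral t mt, hu.eq_integral s ms]
      ring
    have e2 : ∫ x in s..t, primitive k x = primitive (primitive k) t - primitive (primitive k) s :=
      intervalIntegral.integral_eq_sub_of_hasDerivAt (fun x _ => hasDerivAt_primitive hK x)
        (hK.intervalIntegrable _ _)
    rw [intervalIntegral.integral_sub ig (hK.intervalIntegrable _ _), e1, e2]
    ring
  have m1 : MemLp (fun x => indicator (Ioc a b) (1 : ℝ → ℝ) x) 2 leb :=
    (isPrimitive_ramp (b := b) ha).memLp
  have m2 : MemLp (fun x => indicator (Ioc b c) (1 : ℝ → ℝ) x) 2 leb :=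
    (isPrimitive_ramp (b := c) (ha.trans hab.le)).memLp
  have h3 : ∫ x, (g x - primitive k x) * hatDeriv a b c x ∂leb
      = 1 / (b - a) * ∫ x, (g x - primitive k x) * indicator (Ioc a b) 1 x ∂leb
        - 1 / (c - b) * ∫ x, (g x - primitive k x) * indicator (Ioc b c) 1 x ∂leb := by
    rw [← integral_const_mul, ← integral_const_mul,
      ← integral_sub ((integrable_mul_of_memLp hQ m1).const_mul _)
        ((integrable_mul_of_memLp hQ m2).const_mul _)]
    refine integral_congr_ae (Filter.Eventually.of_forall fun x => ?_)
    simp only [hatDeriv]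
    ring
  rw [h2, h3, integral_mul_indicator_Ioc ha hab.le (hbc.le.trans hc),
    integral_mul_indicator_Ioc (ha.trans hab.le) hbc.le hc, hint ha hab.le (hbc.le.trans hc),
    hint (ha.trans hab.le) hbc.le hc]
  ring

end hat

lemma exists_continuous_eqOn {f : ℝ → ℝ} (hf : ContinuousOn f (Icc (-1) 1)) :
    ∃ F : ℝ → ℝ, Continuous F ∧ EqOn F f (Icc (-1) 1) := by
  have h : (-1 : ℝ) ≤ 1 := by norm_num
  refine ⟨IccExtend h ((Icc (-1 : ℝ) 1).domRestrict f),
    (continuousOn_iff_continuous_domRestrict.1 hf).Icc_extend', fun x hx => ?_⟩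
  rw [IccExtend_of_mem h _ hx]
  rfl

/-- A bound for the negative part of the second derivative of the obstacle away from its kink. -/
def obstacleBound (q r : ℝ) : ℝ := alpha q r ^ 2 * Real.exp |alpha q r|

lemma obstacleBound_nonneg (q r : ℝ) : 0 ≤ obstacleBound q r :=
  mul_nonneg (sq_nonneg _) (Real.exp_pos _).le

lemma convexOn_phi_add {q r : ℝ} {m : ℝ → ℝ} (hm : Continuous m)
    (hb : ∀ x, obstacleBound q r ≤ m x) :
    ConvexOn ℝ (Icc (-1) 1) (fun x => phi q r x + primitive (primitive m) x) := by
  have h1 : ConvexOn ℝ (Icc (-1) 1)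
      (fun x => smoothObstacle q r x + primitive (primitive m) x) := by
    set α := alpha q r with hα
    refine convexOn_add_primitive_primitive (convex_Icc _ _)
      (f' := fun x => (α + 1) * Real.exp ((α + 1) * x) - α * Real.exp (α * x))
      (f'' := fun x => (α + 1) * ((α + 1) * Real.exp ((α + 1) * x)) - α * (α * Real.exp (α * x)))
      (fun x => (hasDerivAt_exp_mul _ x).sub (hasDerivAt_exp_mul _ x))
      (fun x => ((hasDerivAt_exp_mul _ x).const_mul _).sub ((hasDerivAt_exp_mul _ x).const_mul _))
      hm fun x hx => ?_
    have h2 : α * x ≤ |α| := by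
      refine (le_abs_self _).trans ?_
      rw [abs_mul]
      exact mul_le_of_le_one_right (abs_nonneg _) (abs_le.2 hx)
    have h3 : α ^ 2 * Real.exp (α * x) ≤ obstacleBound q r :=
      mul_le_mul_of_nonneg_left (Real.exp_le_exp.2 h2) (sq_nonneg _)
    have h4 : 0 ≤ (α + 1) ^ 2 * Real.exp ((α + 1) * x) :=
      mul_nonneg (sq_nonneg _) (Real.exp_pos _).le
    have := hb x
    nlinarith
  have h2 : ConvexOn ℝ (Icc (-1) 1) (fun x => (0 : ℝ) + primitive (primitive m) x) :=
    convexOn_add_primitive_primitive (convex_Icc _ _) (fun x => hasDerivAt_const x (0 : ℝ))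
      (fun x => hasDerivAt_const x (0 : ℝ)) hm fun x _ => by
        linarith [hb x, obstacleBound_nonneg q r]
  have h3 : (fun x => phi q r x + primitive (primitive m) x)
      = (fun x => smoothObstacle q r x + primitive (primitive m) x)
        ⊔ (fun x => (0 : ℝ) + primitive (primitive m) x) := by
    funext x
    simp only [Pi.sup_apply]
    rw [phi_eq_max, max_add_add_right]
  rw [h3]
  exact h1.sup h2

/-- Minimizers belong to `H²(Ω)`, solve the variational inequality almost everywhere, and their
second derivative has a bound that involves `h` only through the difference quotient. -/
lemma minimizer_regularity {q r h : ℝ} {w u g : ℝ → ℝ}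
    (hw : ContinuousOn w (Icc (-1) 1)) (hu : IsCompetitor q r u g)
    (hmin : ∀ v ∈ Admissible q r, J q r h w u ≤ J q r h w v) :
    ∃ U₁ U₂, IsPrimitive u U₁ ∧ IsPrimitive U₁ U₂ ∧
      (∀ᵐ x ∂leb, viOp q r h w u x (U₂ x) = 0) ∧
      ∀ᵐ x ∂leb, |U₂ x| ≤ |(u x - w x) / h + beta q r * u x| + obstacleBound q r := by
  have huc := hu.prim.continuousOn
  obtain ⟨k, hk, hkeq⟩ := exists_continuous_eqOn (f := fun x => (u x - w x) / h + beta q r * u x)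
    (((huc.sub hw).div_const h).add (huc.const_smul (beta q r)))
  have hvar : ∀ {η e : ℝ → ℝ}, IsPrimitive η e → ∀ {t₀ : ℝ}, 0 < t₀ →
      (∀ t ∈ Ioo 0 t₀, (fun x => u x + t * η x) ∈ Admissible q r) →
      0 ≤ ∫ x, g x * e x ∂leb + ∫ x, k x * η x ∂leb := by
    intro η e hη t₀ ht₀ hadm
    have h1 := first_variation_nonneg (memLp_of_continuousOn hw) hu.prim hmin hη ht₀ hadm
    have h2 : ∫ x, k x * η x ∂leb
        = ∫ x, ((u x - w x) / h + beta q r * u x) * η x ∂leb :=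
      integral_congr_ae (ae_leb_of_forall fun x hx => by
        simp only [hkeq (Ioo_subset_Icc_self hx)])
    rwa [h2]
  have hadm : ∀ {η e : ℝ → ℝ}, IsPrimitive η e → η (-1) = 0 → η 1 = 0 → ∀ t : ℝ,
      (∀ x ∈ Icc (-1 : ℝ) 1, phi q r x ≤ u x + t * η x) →
      (fun x => u x + t * η x) ∈ Admissible q r := by
    intro η e hη h1 h2 t h3
    refine IsCompetitor.mem_admissible ⟨hu.prim.add (hη.const_mul t), ?_, ?_, h3⟩
    · rw [h1, mul_zero, add_zero, hu.left]
    · rw [h2, mul_zero, add_zero, hu.right]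
  set m : ℝ → ℝ := fun x => max (-k x) (obstacleBound q r) with hm
  have hmc : Continuous m := hk.neg.max continuous_const
  have hconc : ConcaveOn ℝ (Icc (-1) 1) (fun x => u x - primitive (primitive k) x) := by
    refine concaveOn_of_slope_anti_adjacent (convex_Icc _ _) fun {a b c} ha hc hab hbc => ?_
    have hη := isPrimitive_hat (c := c) ha.1 hab
    have h1 := hvar hη one_pos fun t ht => hadm hη (hat_of_le hab ha.1) (hat_of_ge hab hbc hc.2) t
      fun x hx => by
        have := mul_nonneg ht.1.le (hat_nonneg hab hbc x)
        linarith [hu.phi_le x hx]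
    rw [first_variation_hat hu.prim hk ha.1 hab hbc hc.2] at h1
    linarith
  have hconv : ∀ x ∈ Ioo (-1 : ℝ) 1, phi q r x < u x → ∃ ε > 0,
      Ioo (x - ε) (x + ε) ⊆ Ioo (-1) 1 ∧
      ConvexOn ℝ (Ioo (x - ε) (x + ε)) (fun x => u x - primitive (primitive k) x) := by
    intro x hx hlt
    -- Near `x` the obstacle stays below `u` by a fixed amount `τ`, so that small variations of
    -- both signs are admissible.
    set τ := (u x - phi q r x) / 2 with hτ
    have hτ0 : 0 < τ := by linarith
    have hcont : ContinuousAt (fun y => u y - phi q r y) x :=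
      (huc.continuousAt (Icc_mem_nhds hx.1 hx.2)).sub (continuous_phi q r).continuousAt
    have hev : ∀ᶠ y in nhds x, τ < u y - phi q r y ∧ y ∈ Ioo (-1 : ℝ) 1 :=
      (hcont.eventually_const_lt (by simp only; linarith)).and (Ioo_mem_nhds hx.1 hx.2)
    obtain ⟨ε, hε, hball⟩ := Metric.eventually_nhds_iff_ball.1 hev
    rw [Real.ball_eq_Ioo] at hball
    refine ⟨ε, hε, fun y hy => (hball y hy).2, ?_⟩
    refine convexOn_of_slope_mono_adjacent (convex_Ioo _ _) fun {a b c} ha hc hab hbc => ?_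
    have ha1 := (hball a ha).2.1.le
    have hc1 := (hball c hc).2.2.le
    have hη := isPrimitive_hat (c := c) ha1 hab
    have h1 := hvar (hη.const_mul (-1)) hτ0 fun t ht => hadm (hη.const_mul (-1))
      (by rw [hat_of_le hab ha1, mul_zero]) (by rw [hat_of_ge hab hbc hc1, mul_zero]) t
      fun y hy => by
        rcases le_or_gt y a with h2 | h2
        · rw [hat_of_le hab h2]; simpa using hu.phi_le y hy
        rcases le_or_gt c y with h3 | h3
        · rw [hat_of_ge hab hbc h3]; simpa using hu.phi_le y hy
        have h4 := (hball y ⟨ha.1.trans h2, h3.trans hc.2⟩).1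
        have h5 := mul_le_mul ht.2.le (hat_le_one hab hbc y) (hat_nonneg hab hbc y) hτ0.le
        linarith
    have e1 : ∫ x, g x * (-1 * hatDeriv a b c x) ∂leb + ∫ x, k x * (-1 * hat a b c x) ∂leb
        = -(∫ x, g x * hatDeriv a b c x ∂leb + ∫ x, k x * hat a b c x ∂leb) := by
      simp only [neg_mul, one_mul, mul_neg, integral_neg]
      ring
    rw [e1, first_variation_hat hu.prim hk ha1 hab hbc hc1] at h1
    linarith
  obtain ⟨U₁, U₂, h1, h2, h3⟩ := exists_second_derivative huc hk hmc (fun x => le_max_left _ _)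
    hu.phi_le (convexOn_phi_add hmc fun x => le_max_right _ _) hconc hconv
  refine ⟨U₁, U₂, h1, h2, ?_, ?_⟩
  · filter_upwards [h3, ae_leb_of_forall (p := fun x => x ∈ Ioo (-1 : ℝ) 1) fun _ h => h]
      with x hx hxm
    have hx' := Ioo_subset_Icc_self hxm
    have e : (u x - w x) / h - U₂ x + beta q r * u x = k x - U₂ x := by rw [hkeq hx']; ring
    rw [viOp, e]
    rcases (hu.phi_le x hx').eq_or_lt with heq | hlt
    · rw [heq, sub_self, min_eq_right (by linarith [hx.1])]
    · rw [hx.2.2 hlt, sub_self, min_eq_left (by linarith)]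
  · filter_upwards [h3, ae_leb_of_forall (p := fun x => x ∈ Ioo (-1 : ℝ) 1) fun _ h => h]
      with x hx hxm
    have e : (u x - w x) / h + beta q r * u x = k x := (hkeq (Ioo_subset_Icc_self hxm)).symm
    rw [e, abs_le]
    have b1 := obstacleBound_nonneg q r
    have b2 : m x ≤ |k x| + obstacleBound q r :=
      max_le (by linarith [neg_le_abs (k x)]) (by linarith [abs_nonneg (k x)])
    constructor
    · linarith [hx.2.1]
    · linarith [hx.1, le_abs_self (k x)]

lemma weakDeriv_weakDeriv_ae_eq {u U₁ U₂ : ℝ → ℝ} (h1 : IsPrimitive u U₁)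
    (h2 : IsPrimitive U₁ U₂) : weakDeriv (weakDeriv u) =ᵐ[leb] U₂ :=
  weakDeriv_ae_eq h2 h1.weakDeriv_ae_eq

lemma isAESolution_of_isPrimitive {q r h : ℝ} {w u g U₁ U₂ : ℝ → ℝ} (hu : IsCompetitor q r u g)
    (h1 : IsPrimitive u U₁) (h2 : IsPrimitive U₁ U₂)
    (h3 : ∀ᵐ x ∂leb, viOp q r h w u x (U₂ x) = 0) : IsAESolution q r h w u where
  continuousOn := hu.prim.continuousOn
  memH2 := ⟨h1.memH1, memH1_of_ae_eq_isPrimitive h2 h1.weakDeriv_ae_eq⟩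
  eq_zero := by
    filter_upwards [h3, weakDeriv_weakDeriv_ae_eq h1 h2] with x hx e
    rwa [e]
  left := hu.left
  right := hu.right

/-! ### Almost everywhere solutions are viscosity solutions -/

lemma IsPrimitive.congr_deriv {v g f : ℝ → ℝ} (hv : IsPrimitive v g) (h : g =ᵐ[leb] f) :
    IsPrimitive v f := by
  refine ⟨hv.memLp.ae_eq h, fun x hx => ?_⟩
  rw [hv.eq_integral x hx]
  congr 1
  refine intervalIntegral.integral_congr_ae ?_
  have h1 : ∀ᵐ t : ℝ, t ≠ 1 := by simp [ae_iff]
  filter_upwards [ae_leb_iff.1 h, h1] with t ht ht1 hm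
  rw [uIoc_of_le hx.1] at hm
  exact ht ⟨hm.1, lt_of_le_of_ne (hm.2.trans hx.2) ht1⟩

lemma IsPrimitive.hasDerivAt {v g : ℝ → ℝ} (hv : IsPrimitive v g)
    (hg : ContinuousOn g (Icc (-1) 1)) {x : ℝ} (hx : x ∈ Ioo (-1 : ℝ) 1) :
    HasDerivAt v (g x) x := by
  obtain ⟨G, hG, hGg⟩ := exists_continuous_eqOn hg
  have h1 : ∀ y ∈ Icc (-1 : ℝ) 1, v y = v (-1) + primitive G y := by
    intro y hy
    rw [hv.eq_integral y hy, primitive]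
    congr 1
    refine intervalIntegral.integral_congr fun t ht => ?_
    rw [uIcc_of_le hy.1] at ht
    exact (hGg ⟨ht.1, ht.2.trans hy.2⟩).symm
  rw [← hGg (Ioo_subset_Icc_self hx)]
  refine ((hasDerivAt_primitive hG x).const_add (v (-1))).congr_of_eventuallyEq ?_
  filter_upwards [Icc_mem_nhds hx.1 hx.2] with y hy using h1 y hy

lemma not_isLocalMax_of_second_deriv_pos {D D₁ d : ℝ → ℝ} {x b c : ℝ} (hxb : x < b) (hc : 0 < c)
    (hD : ∀ y ∈ Ico x b, HasDerivAt D (D₁ y) y)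
    (hD₁ : ∀ y ∈ Ico x b, D₁ y - D₁ x = ∫ t in x..y, d t)
    (hdi : IntervalIntegrable d volume x b) (hd : ∀ᵐ t, t ∈ Ico x b → c ≤ d t) :
    ¬ IsLocalMax D x := by
  intro hmax
  have h0 : D₁ x = 0 := hmax.hasDerivAt_eq_zero (hD x ⟨le_rfl, hxb⟩)
  have hpos : ∀ y ∈ Ioo x b, 0 < D₁ y := by
    intro y hy
    have h1 := hD₁ y ⟨hy.1.le, hy.2⟩
    have h2 : ∫ _t in x..y, c ≤ ∫ t in x..y, d t := by
      refine intervalIntegral.integral_mono_ae_restrict hy.1.le (by simp) (hdi.mono_set ?_) ?_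
      · rw [uIcc_of_le hy.1.le, uIcc_of_le hxb.le]
        exact Icc_subset_Icc le_rfl hy.2.le
      · refine (ae_restrict_iff' measurableSet_Icc).2 ?_
        filter_upwards [hd] with t ht hm using ht ⟨hm.1, hm.2.trans_lt hy.2⟩
    rw [intervalIntegral.integral_const, smul_eq_mul] at h2
    have h3 : 0 < (y - x) * c := mul_pos (by linarith [hy.1]) hc
    linarith
  have hmono : StrictMonoOn D (Ico x b) := by
    refine strictMonoOn_of_deriv_pos (convex_Ico _ _)
      (fun y hy => (hD y hy).continuousAt.continuousWithinAt) fun y hy => ?_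
    rw [interior_Ico] at hy
    rw [(hD y ⟨hy.1.le, hy.2⟩).deriv]
    exact hpos y hy
  have h4 : ∀ᶠ y in nhdsWithin x (Ioi x), D y ≤ D x := hmax.filter_mono nhdsWithin_le_nhds
  obtain ⟨y, hy1, hy2⟩ := (h4.and (Ioo_mem_nhdsGT hxb)).exists
  exact hy1.not_gt (hmono ⟨le_rfl, hxb⟩ ⟨hy2.1.le, hy2.2⟩ hy2.1)

lemma hasDerivAt_deriv_of_contDiff_two {ψ : ℝ → ℝ} (hψ : ContDiff ℝ 2 ψ) (x : ℝ) :
    HasDerivAt ψ (deriv ψ x) x := (hψ.differentiable (by simp) x).hasDerivAt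

lemma contDiff_one_deriv {ψ : ℝ → ℝ} (hψ : ContDiff ℝ 2 ψ) : ContDiff ℝ 1 (deriv ψ) := by
  rw [show (2 : WithTop ℕ∞) = 1 + 1 by norm_num, contDiff_succ_iff_deriv] at hψ
  exact hψ.2.2

lemma continuous_deriv_deriv {ψ : ℝ → ℝ} (hψ : ContDiff ℝ 2 ψ) :
    Continuous (deriv (deriv ψ)) := (contDiff_one_deriv hψ).continuous_deriv_one

lemma IsAESolution.isViscositySolution {q r h : ℝ} {w v : ℝ → ℝ}
    (hw : ContinuousOn w (Icc (-1) 1)) (hv : IsAESolution q r h w v) :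
    IsViscositySolution q r h w v := by
  have hvc := hv.continuousOn
  have hv1 := isPrimitive_weakDeriv hvc hv.memH2.1
  obtain ⟨V₁, hV₁, hae⟩ := exists_isPrimitive_of_memH1 hv.memH2.2.1
    hv.memH2.2.weakDeriv_spec.1 hv.memH2.2.weakDeriv_spec.2
  set V₂ := weakDeriv (weakDeriv v) with hV₂
  have hvd : ∀ x ∈ Ioo (-1 : ℝ) 1, HasDerivAt v (V₁ x) x := fun x hx =>
    (hv1.congr_deriv hae).hasDerivAt hV₁.continuousOn hx
  set k : ℝ → ℝ := fun x => (v x - w x) / h + beta q r * v x with hk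
  have hkc : ContinuousOn k (Icc (-1) 1) :=
    ((hvc.sub hw).div_const h).add (hvc.const_smul (beta q r))
  have hop : ∀ x X, viOp q r h w v x X = min (k x - X) (v x - phi q r x) := by
    intro x X
    rw [viOp, hk]
    congr 1
    ring
  have hvi : ∀ᵐ x, x ∈ Ioo (-1 : ℝ) 1 → min (k x - V₂ x) (v x - phi q r x) = 0 := by
    refine ae_leb_iff.1 (hv.eq_zero.mono fun x hx => ?_)
    rwa [hop] at hx
  have hφ : ∀ x ∈ Icc (-1 : ℝ) 1, phi q r x ≤ v x := by
    refine le_of_ae_le (continuous_phi q r).continuousOn hvc (ae_leb_iff.2 (hvi.mono ?_))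
    intro x hx hm
    linarith [(hx hm).ge.trans (min_le_right _ _)]
  have hint : ∀ {ψ : ℝ → ℝ}, ContDiff ℝ 2 ψ → ∀ {x y : ℝ}, x ∈ Ioo (-1 : ℝ) 1 →
      y ∈ Ioo (-1 : ℝ) 1 → IntervalIntegrable (fun t => V₂ t - deriv (deriv ψ) t) volume x y ∧
      ∫ t in x..y, (V₂ t - deriv (deriv ψ) t) = (V₁ y - deriv ψ y) - (V₁ x - deriv ψ x) := by
    intro ψ hψ x y hx hy
    have hx' := Ioo_subset_Icc_self hx
    have hy' := Ioo_subset_Icc_self hy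
    have i1 : IntervalIntegrable V₂ volume x y :=
      (hV₁.intervalIntegrable_of_mem hx').symm.trans (hV₁.intervalIntegrable_of_mem hy')
    have i2 := (continuous_deriv_deriv hψ).intervalIntegrable (μ := volume) x y
    have e1 : ∫ t in x..y, V₂ t = V₁ y - V₁ x := by
      rw [← intervalIntegral.integral_interval_sub_left (hV₁.intervalIntegrable_of_mem hy')
        (hV₁.intervalIntegrable_of_mem hx'), hV₁.eq_integral y hy', hV₁.eq_integral x hx']
      ring
    have e2 : ∫ t in x..y, deriv (deriv ψ) t = deriv ψ y - deriv ψ x :=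
      intervalIntegral.integral_eq_sub_of_hasDerivAt
        (fun t _ => ((contDiff_one_deriv hψ).differentiable (by simp) t).hasDerivAt) i2
    refine ⟨i1.sub i2, ?_⟩
    rw [intervalIntegral.integral_sub i1 i2, e1, e2]
    ring
  refine ⟨hvc, fun ψ hψ x hx hmax => ?_, fun ψ hψ x hx hmin => ?_, hv.left, hv.right⟩
  · by_contra! hlt
    rw [hop, lt_min_iff] at hlt
    have hx' : x ∈ Ioo (-1 : ℝ) 1 := hx
    have hnhds := Icc_mem_nhds hx'.1 hx'.2
    set c := (k x - deriv (deriv ψ) x) / 2 with hc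
    have hc0 : 0 < c := by linarith [hlt.1]
    have c1 : ContinuousAt (fun y => k y - deriv (deriv ψ) y) x :=
      (hkc.continuousAt hnhds).sub (continuous_deriv_deriv hψ).continuousAt
    have c2 : ContinuousAt (fun y => v y - phi q r y) x :=
      (hvc.continuousAt hnhds).sub (continuous_phi q r).continuousAt
    have hev := (c1.eventually_const_lt (show c < _ by simp only; linarith)).and
      ((c2.eventually_const_lt hlt.2).and (Ioo_mem_nhds hx'.1 hx'.2))
    obtain ⟨ε, hε, hball⟩ := Metric.eventually_nhds_iff_ball.1 hev
    rw [Real.ball_eq_Ioo] at hball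
    have hIco : ∀ y ∈ Ico x (x + ε / 2), y ∈ Ioo (x - ε) (x + ε) := fun y hy =>
      ⟨by linarith [hy.1], by linarith [hy.2]⟩
    refine not_isLocalMax_of_second_deriv_pos (D₁ := fun y => V₁ y - deriv ψ y)
      (d := fun t => V₂ t - deriv (deriv ψ) t) (by linarith : x < x + ε / 2) hc0
      (fun y hy => (hvd y (hball y (hIco y hy)).2.2).sub (hasDerivAt_deriv_of_contDiff_two hψ y))
      (fun y hy => (hint hψ hx' (hball y (hIco y hy)).2.2).2.symm)
      (hint hψ hx' (hball (x + ε / 2) ⟨by linarith, by linarith⟩).2.2).1 ?_ hmax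
    filter_upwards [hvi] with t ht hm
    obtain ⟨b1, b2, b3⟩ := hball t (hIco t hm)
    have e := ht b3
    rcases min_choice (k t - V₂ t) (v t - phi q r t) with e' | e' <;> rw [e'] at e <;> linarith
  · by_contra! hlt
    rw [hop, min_lt_iff] at hlt
    have hx' : x ∈ Ioo (-1 : ℝ) 1 := hx
    have hnhds := Icc_mem_nhds hx'.1 hx'.2
    have hlt' : k x - deriv (deriv ψ) x < 0 :=
      hlt.resolve_right (by linarith [hφ x (Ioo_subset_Icc_self hx')])
    set c := -(k x - deriv (deriv ψ) x) / 2 with hc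
    have hc0 : 0 < c := by linarith
    have c1 : ContinuousAt (fun y => deriv (deriv ψ) y - k y) x :=
      (continuous_deriv_deriv hψ).continuousAt.sub (hkc.continuousAt hnhds)
    have hev := (c1.eventually_const_lt (show c < _ by simp only; linarith)).and
      (Ioo_mem_nhds hx'.1 hx'.2)
    obtain ⟨ε, hε, hball⟩ := Metric.eventually_nhds_iff_ball.1 hev
    rw [Real.ball_eq_Ioo] at hball
    have hIco : ∀ y ∈ Ico x (x + ε / 2), y ∈ Ioo (x - ε) (x + ε) := fun y hy =>
      ⟨by linarith [hy.1], by linarith [hy.2]⟩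
    refine not_isLocalMax_of_second_deriv_pos (D := fun y => -(v y - ψ y))
      (D₁ := fun y => -(V₁ y - deriv ψ y))
      (d := fun t => -(V₂ t - deriv (deriv ψ) t)) (by linarith : x < x + ε / 2) hc0
      (fun y hy => ((hvd y (hball y (hIco y hy)).2).sub
        (hasDerivAt_deriv_of_contDiff_two hψ y)).neg)
      (fun y hy => ?_)
      (hint hψ hx' (hball (x + ε / 2) ⟨by linarith, by linarith⟩).2).1.neg ?_ hmin.neg
    · rw [intervalIntegral.integral_neg, (hint hψ hx' (hball y (hIco y hy)).2).2]
      ring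
    · filter_upwards [hvi] with t ht hm
      obtain ⟨b1, b3⟩ := hball t (hIco t hm)
      have e := (ht b3).ge.trans (min_le_left _ _)
      linarith

/-! ### Uniqueness of viscosity solutions -/

/-- Comparison of a viscosity subsolution of `v_xx = k` with a classical solution. -/
lemma le_of_viscosity_subsolution {a b : ℝ} {v z k : ℝ → ℝ} (hv : ContinuousOn v (Icc a b))
    (hz : ContDiff ℝ 2 z) (hzk : ∀ x ∈ Ioo a b, deriv (deriv z) x = k x)
    (hsub : ∀ ψ : ℝ → ℝ, ContDiff ℝ 2 ψ → ∀ x ∈ Ioo a b,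
      IsLocalMax (fun y => v y - ψ y) x → k x ≤ deriv (deriv ψ) x)
    (ha : v a ≤ z a) (hb : v b ≤ z b) : ∀ x ∈ Icc a b, v x ≤ z x := by
  by_contra! hne
  obtain ⟨x, hx, hlt⟩ := hne
  -- Adding a small concave parabola to `z` gives a strict supersolution.
  set δ := (v x - z x) / ((b - a) ^ 2 + 1) with hδ
  have hden : 0 < (b - a) ^ 2 + 1 := by positivity
  have hδ0 : 0 < δ := div_pos (by linarith) hden
  have hδe : δ * ((b - a) ^ 2 + 1) = v x - z x := div_mul_cancel₀ _ hden.ne'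
  set ψ : ℝ → ℝ := fun y => z y + δ * ((y - a) * (b - y)) with hψ
  have hψc : ContDiff ℝ 2 ψ := by
    refine hz.add (contDiff_const.mul ?_)
    exact (contDiff_id.sub contDiff_const).mul (contDiff_const.sub contDiff_id)
  have hψ1 : deriv ψ = fun y => deriv z y + δ * (a + b - 2 * y) := by
    funext y
    have h1 : HasDerivAt (fun y : ℝ => (y - a) * (b - y)) (1 * (b - y) + (y - a) * (-1)) y :=
      ((hasDerivAt_id y).sub_const a).mul ((hasDerivAt_id y).const_sub b)
    have h2 := (hasDerivAt_deriv_of_contDiff_two hz y).add (h1.const_mul δ)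
    refine h2.deriv.trans ?_
    ring
  have hψ2 : ∀ y, deriv (deriv ψ) y = deriv (deriv z) y - 2 * δ := by
    intro y
    rw [hψ1]
    have h1 : HasDerivAt (fun y : ℝ => a + b - 2 * y) (-(2 * 1)) y :=
      ((hasDerivAt_id y).const_mul 2).const_sub (a + b)
    have h2 := ((contDiff_one_deriv hz).differentiable (by simp) y).hasDerivAt.add (h1.const_mul δ)
    refine h2.deriv.trans ?_
    ring
  obtain ⟨t, ht, hmax⟩ := isCompact_Icc.exists_isMaxOn ⟨x, hx⟩
    (hv.sub hψc.continuous.continuousOn)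
  have hpos : 0 < v t - ψ t := by
    refine lt_of_lt_of_le ?_ (hmax hx)
    have h1 : (x - a) * (b - x) ≤ (b - a) ^ 2 := by nlinarith [hx.1, hx.2]
    have h2 := mul_le_mul_of_nonneg_left h1 hδ0.le
    simp only [hψ, Pi.sub_apply]
    nlinarith
  have hta : a < t := lt_of_le_of_ne ht.1 fun e => by
    rw [← e] at hpos; simp only [hψ] at hpos; linarith
  have htb : t < b := lt_of_le_of_ne ht.2 fun e => by
    rw [e] at hpos; simp only [hψ] at hpos; linarith
  have h3 := hsub ψ hψc t ⟨hta, htb⟩ (hmax.isLocalMax (Icc_mem_nhds hta htb))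
  rw [hψ2, hzk t ⟨hta, htb⟩] at h3
  linarith

/-- A viscosity solution of `v_xx = k` with continuous `k` is a classical solution. -/
lemma exists_contDiff_eqOn_of_viscosity {a b : ℝ} (hab : a < b) {v k : ℝ → ℝ}
    (hv : ContinuousOn v (Icc a b)) (hk : Continuous k)
    (hsub : ∀ ψ : ℝ → ℝ, ContDiff ℝ 2 ψ → ∀ x ∈ Ioo a b,
      IsLocalMax (fun y => v y - ψ y) x → k x ≤ deriv (deriv ψ) x)
    (hsup : ∀ ψ : ℝ → ℝ, ContDiff ℝ 2 ψ → ∀ x ∈ Ioo a b,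
      IsLocalMin (fun y => v y - ψ y) x → deriv (deriv ψ) x ≤ k x) :
    ∃ z : ℝ → ℝ, ContDiff ℝ 2 z ∧ (∀ x, deriv (deriv z) x = k x) ∧ EqOn v z (Icc a b) := by
  set K := primitive (primitive k) with hK
  have hKc := contDiff_two_primitive_primitive hk
  set σ := ((v b - K b) - (v a - K a)) / (b - a) with hσ
  have hσe : σ * (b - a) = (v b - K b) - (v a - K a) := div_mul_cancel₀ _ (by linarith)
  set z : ℝ → ℝ := fun x => K x + (v a - K a + σ * (x - a)) with hz
  have hzc : ContDiff ℝ 2 z := by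
    refine hKc.add (contDiff_const.add (contDiff_const.mul (contDiff_id.sub contDiff_const)))
  have hz1 : deriv z = fun y => primitive k y + σ := by
    funext y
    have h1 : HasDerivAt (fun y : ℝ => v a - K a + σ * (y - a)) (σ * 1) y :=
      (((hasDerivAt_id y).sub_const a).const_mul σ).const_add _
    refine ((hasDerivAt_primitive (continuous_primitive hk) y).add h1).deriv.trans ?_
    ring
  have hz2 : ∀ x, deriv (deriv z) x = k x := fun x => by
    rw [hz1]; exact ((hasDerivAt_primitive hk x).add_const σ).deriv
  have hza : z a = v a := by simp [hz]
  have hzb : z b = v b := by simp only [hz]; linarith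
  refine ⟨z, hzc, hz2, fun x hx => le_antisymm ?_ ?_⟩
  · exact le_of_viscosity_subsolution hv hzc (fun x _ => hz2 x) hsub hza.ge hzb.ge x hx
  · have hneg : ∀ f : ℝ → ℝ, ∀ y, deriv (deriv fun t => -f t) y = -deriv (deriv f) y := by
      intro f y
      rw [deriv.fun_neg', deriv.fun_neg]
    have h1 := le_of_viscosity_subsolution (v := fun y => -v y) (z := fun y => -z y)
      (k := fun y => -k y) hv.neg hzc.neg (fun x _ => by rw [hneg, hz2])
      (fun ψ hψ y hy hmax => by
        have h2 := hsup (fun t => -ψ t) hψ.neg y hy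
          (hmax.neg.congr (Filter.Eventually.of_forall fun t => by ring) )
        rw [hneg] at h2
        linarith)
      (neg_le_neg hza.le) (neg_le_neg hzb.le) x hx
    linarith

/-- Viscosity supersolutions lie above the obstacle: they can be touched from below by parabolas
on a dense set of points. -/
lemma IsViscositySolution.phi_le {q r h : ℝ} {w v : ℝ → ℝ} (hv : IsViscositySolution q r h w v)
    {x : ℝ} (hx : x ∈ Ioo (-1 : ℝ) 1) : phi q r x ≤ v x := by
  by_contra! hlt
  have hnhds := Icc_mem_nhds hx.1 hx.2
  have hev := ((hv.continuousOn.continuousAt hnhds).eventually_lt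
    (continuous_phi q r).continuousAt hlt).and (Ioo_mem_nhds hx.1 hx.2)
  obtain ⟨ε, hε, hball⟩ := Metric.eventually_nhds_iff_ball.1 hev
  rw [Real.ball_eq_Ioo] at hball
  set δ := ε / 2 with hδ
  have hδ0 : 0 < δ := by positivity
  have hsub : ∀ y ∈ Icc (x - δ) (x + δ), y ∈ Ioo (x - ε) (x + ε) := fun y hy =>
    ⟨by linarith [hy.1], by linarith [hy.2]⟩
  have hvc : ContinuousOn v (Icc (x - δ) (x + δ)) :=
    hv.continuousOn.mono fun y hy => Ioo_subset_Icc_self (hball y (hsub y hy)).2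
  obtain ⟨C, hC⟩ := isCompact_Icc.exists_bound_of_continuousOn hvc
  have hC0 : 0 ≤ C := (norm_nonneg _).trans (hC x ⟨by linarith, by linarith⟩)
  set N := (2 * C + 1) / δ ^ 2 with hN
  have hNe : N * δ ^ 2 = 2 * C + 1 := div_mul_cancel₀ _ (by positivity)
  set ψ : ℝ → ℝ := fun y => -(N * (y - x) ^ 2) with hψ
  have hψc : ContDiff ℝ 2 ψ := by
    exact (contDiff_const.mul ((contDiff_id.sub contDiff_const).pow 2)).neg
  obtain ⟨t, ht, hmin⟩ := isCompact_Icc.exists_isMinOn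
    (nonempty_Icc.2 (by linarith : x - δ ≤ x + δ)) (hvc.sub hψc.continuous.continuousOn)
  have hxm : x ∈ Icc (x - δ) (x + δ) := ⟨by linarith, by linarith⟩
  have h1 : v t + N * (t - x) ^ 2 ≤ v x := by
    have : v t - ψ t ≤ v x - ψ x := hmin hxm
    simp only [hψ] at this
    nlinarith
  have b1 := abs_le.1 (hC t ht)
  have b2 := abs_le.1 (hC x hxm)
  have hta : x - δ < t := lt_of_le_of_ne ht.1 fun e => by
    rw [← e] at h1 b1
    have : (x - δ - x) ^ 2 = δ ^ 2 := by ring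
    rw [this, hNe] at h1
    linarith
  have htb : t < x + δ := lt_of_le_of_ne ht.2 fun e => by
    rw [e] at h1 b1
    have : (x + δ - x) ^ 2 = δ ^ 2 := by ring
    rw [this, hNe] at h1
    linarith
  have h2 := hball t (hsub t ht)
  have h3 := hv.super ψ hψc t h2.2 (hmin.isLocalMin (Icc_mem_nhds hta htb))
  have h4 := h3.trans (min_le_right _ _)
  linarith [h2.1]

/-- Comparison of viscosity solutions. Near a positive maximum of `v - u` the function `v` lies
strictly above the obstacle, is therefore twice continuously differentiable, and can be used as a
test function for `u`. -/
lemma IsViscositySolution.le {q r h : ℝ} (hr : 0 < r) (hh : 0 < h) {w u v : ℝ → ℝ}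
    (hw : ContinuousOn w (Icc (-1) 1)) (hu : IsViscositySolution q r h w u)
    (hv : IsViscositySolution q r h w v) : ∀ x ∈ Icc (-1 : ℝ) 1, v x ≤ u x := by
  by_contra! hne
  obtain ⟨y, hy, hlt⟩ := hne
  have hvc := hv.continuousOn
  obtain ⟨x, hx, hmax⟩ := isCompact_Icc.exists_isMaxOn ⟨y, hy⟩ (hvc.sub hu.continuousOn)
  have hpos : 0 < v x - u x := lt_of_lt_of_le (by simp only [Pi.sub_apply]; linarith) (hmax hy)
  have hxa : -1 < x := lt_of_le_of_ne hx.1 fun e => by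
    rw [← e, hv.left, hu.left] at hpos; linarith
  have hxb : x < 1 := lt_of_le_of_ne hx.2 fun e => by
    rw [e, hv.right, hu.right] at hpos; linarith
  have hx' : x ∈ Ioo (-1 : ℝ) 1 := ⟨hxa, hxb⟩
  have hφ : phi q r x < v x := by linarith [hu.phi_le hx']
  have hnhds := Icc_mem_nhds hxa hxb
  have hev := ((continuous_phi q r).continuousAt.eventually_lt
    (hvc.continuousAt hnhds) hφ).and (Ioo_mem_nhds hxa hxb)
  obtain ⟨ε, hε, hball⟩ := Metric.eventually_nhds_iff_ball.1 hev
  rw [Real.ball_eq_Ioo] at hball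
  have hsub : ∀ y ∈ Icc (x - ε / 2) (x + ε / 2), y ∈ Ioo (x - ε) (x + ε) := fun y hy =>
    ⟨by linarith [hy.1], by linarith [hy.2]⟩
  have hsub' : Icc (x - ε / 2) (x + ε / 2) ⊆ Icc (-1) 1 := fun y hy =>
    Ioo_subset_Icc_self (hball y (hsub y hy)).2
  obtain ⟨k, hk, hkeq⟩ := exists_continuous_eqOn (f := fun x => (v x - w x) / h + beta q r * v x)
    (((hvc.sub hw).div_const h).add (hvc.const_smul (beta q r)))
  obtain ⟨z, hzc, hz2, hvz⟩ := exists_contDiff_eqOn_of_viscosity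
    (show x - ε / 2 < x + ε / 2 by linarith) (hvc.mono hsub') hk
    (fun ψ hψ t ht hm => by
      have ht' := Ioo_subset_Icc_self ht
      have hb := hball t (hsub t ht')
      have h1 := hv.sub ψ hψ t hb.2 hm
      rw [viOp, min_le_iff] at h1
      have h2 := h1.resolve_right (by linarith [hb.1])
      have h3 := hkeq (hsub' ht')
      simp only at h3
      linarith)
    (fun ψ hψ t ht hm => by
      have ht' := Ioo_subset_Icc_self ht
      have h1 := (hv.super ψ hψ t (hball t (hsub t ht')).2 hm).trans (min_le_left _ _)
      have h3 := hkeq (hsub' ht')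
      simp only at h3
      linarith)
  have hmin : IsLocalMin (fun y => u y - z y) x := by
    have h1 : IsLocalMin (fun y => u y - v y) x :=
      (hmax.isLocalMax hnhds).neg.congr (Filter.Eventually.of_forall fun t => by
        simp only [Pi.sub_apply]; ring)
    refine h1.congr ?_
    filter_upwards [Icc_mem_nhds (show x - ε / 2 < x by linarith) (show x < x + ε / 2 by linarith)]
      with t ht
    rw [hvz ht]
  have h1 := (hu.super z hzc x hx' hmin).trans (min_le_left _ _)
  have h2 := hkeq hx
  simp only at h2
  rw [hz2, h2] at h1
  have h3 : (u x - w x) / h - ((v x - w x) / h + beta q r * v x) + beta q r * u x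
      = -((1 / h + beta q r) * (v x - u x)) := by ring
  rw [h3] at h1
  have h4 : 0 < (1 / h + beta q r) * (v x - u x) :=
    mul_pos (add_pos (by positivity) (beta_pos hr)) hpos
  linarith

lemma IsViscositySolution.eqOn {q r h : ℝ} (hr : 0 < r) (hh : 0 < h) {w u v : ℝ → ℝ}
    (hw : ContinuousOn w (Icc (-1) 1)) (hu : IsViscositySolution q r h w u)
    (hv : IsViscositySolution q r h w v) : EqOn v u (Icc (-1) 1) := fun x hx =>
  le_antisymm (hu.le hr hh hw hv x hx) (hv.le hr hh hw hu x hx)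

/-! ### Existence of the discrete Morse semiflow and energy estimates -/

lemma exists_isDMS {q r T h : ℝ} (hr : 0 < r) (hh : 0 < h) : ∃ u, IsDMS q r T h u := by
  have hstep : ∀ w : {v : ℝ → ℝ // ∃ g, IsCompetitor q r v g},
      ∃ v : {v : ℝ → ℝ // ∃ g, IsCompetitor q r v g},
        ∀ v' ∈ Admissible q r, J q r h w.1 v.1 ≤ J q r h w.1 v' := by
    rintro ⟨w, f, hw⟩
    obtain ⟨V, g, hV, hmin⟩ := exists_minimizer hr hh hw.prim.memLp_self
    exact ⟨⟨V, g, hV⟩, hmin⟩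
  choose F hF using hstep
  let u : ℕ → {v : ℝ → ℝ // ∃ g, IsCompetitor q r v g} := fun n =>
    F^[n] ⟨phi q r, phiDeriv q r, isCompetitor_phi q r⟩
  have hu : ∀ n, u (n + 1) = F (u n) := fun n => Function.iterate_succ_apply' F n _
  refine ⟨fun n => (u n).1, fun _ _ => rfl, fun m _ => ?_, fun m _ => ?_, fun m _ v hv => ?_⟩
  · obtain ⟨g, hg⟩ := (u (m + 1)).2
    exact hg.prim.continuousOn
  · obtain ⟨g, hg⟩ := (u (m + 1)).2
    exact hg.mem_admissible
  · rw [hu]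
    exact hF (u m) v hv

namespace IsDMS

variable {q r T h : ℝ} {u : ℕ → ℝ → ℝ}

lemma isCompetitor (hu : IsDMS q r T h u) {m : ℕ} (hm : m ≤ ⌊T / h⌋₊) :
    ∃ g, IsCompetitor q r (u m) g := by
  cases m with
  | zero => exact ⟨_, (isCompetitor_phi q r).congr hu.zero⟩
  | succ m => exact ⟨_, isCompetitor_of_mem_admissible (hu.continuousOn m hm) (hu.mem m hm)⟩

end IsDMS

/-- Twice the part of the functional that does not involve the previous time step. -/
def energy (q r : ℝ) (v : ℝ → ℝ) : ℝ :=
  L2Norm (weakDeriv v) ^ 2 + beta q r * L2Norm v ^ 2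

lemma memLp_difference_quotient {v w : ℝ → ℝ} (hv : MemLp v 2 leb) (hw : MemLp w 2 leb) (h : ℝ) :
    MemLp (fun x => (v x - w x) / h) 2 leb := by
  have h1 : MemLp (fun x => v x - w x) 2 leb := hv.sub hw
  simpa only [div_eq_inv_mul] using h1.const_mul h⁻¹

lemma two_mul_J_eq_energy {q r h : ℝ} (hh : 0 < h) {w V g : ℝ → ℝ} (hw : MemLp w 2 leb)
    (hV : IsPrimitive V g) :
    2 * J q r h w V = h * L2Norm (fun x => (V x - w x) / h) ^ 2 + energy q r V := by
  have hm1 : MemLp (fun x => (V x - w x) / h) 2 leb :=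
    memLp_difference_quotient hV.memLp_self hw h
  have i1 := (integrable_sq_of_memLp hm1).const_mul h
  have i2 := integrable_sq_of_memLp hV.memLp
  have i3 := (integrable_sq_of_memLp hV.memLp_self).const_mul (beta q r)
  have i4 : Integrable (fun x => g x ^ 2 + beta q r * V x ^ 2) leb := i2.add i3
  rw [energy, L2Norm_congr hV.weakDeriv_ae_eq, L2Norm_sq hm1, L2Norm_sq hV.memLp,
    L2Norm_sq hV.memLp_self, J_eq hV (ae_eq_refl V), ← integral_const_mul h,
    ← integral_const_mul (beta q r), ← integral_add i2 i3, ← integral_add i1 i4,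
    ← mul_assoc, show (2 : ℝ) * (1 / 2) = 1 by norm_num, one_mul]
  refine integral_congr_ae (Filter.Eventually.of_forall fun x => ?_)
  beta_reduce
  field_simp
  ring

lemma energy_nonneg {q r : ℝ} (hr : 0 < r) (v : ℝ → ℝ) : 0 ≤ energy q r v :=
  add_nonneg (sq_nonneg _) (mul_nonneg (beta_pos hr).le (sq_nonneg _))

namespace IsDMS

variable {q r T h : ℝ} {u : ℕ → ℝ → ℝ}

/-- Comparison of the minimizer `u (m + 1)` with `u m`. -/
lemma energy_step (hh : 0 < h) (hu : IsDMS q r T h u) {m : ℕ} (hm : m < ⌊T / h⌋₊) :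
    h * L2Norm (fun x => (u (m + 1) x - u m x) / h) ^ 2 + energy q r (u (m + 1))
      ≤ energy q r (u m) := by
  obtain ⟨g, hg⟩ := hu.isCompetitor hm.le
  obtain ⟨g', hg'⟩ := hu.isCompetitor hm
  have h1 := hu.minimal m hm (u m) hg.mem_admissible
  have h2 := two_mul_J_eq_energy (q := q) (r := r) hh hg.prim.memLp_self hg'.prim
  have h3 := two_mul_J_eq_energy (q := q) (r := r) hh hg.prim.memLp_self hg.prim
  have h4 : L2Norm (fun x => (u m x - u m x) / h) = 0 := by simp [L2Norm]
  rw [h4] at h3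
  linarith

lemma sum_add_energy_le (hh : 0 < h) (hu : IsDMS q r T h u) {n : ℕ} (hn : n ≤ ⌊T / h⌋₊) :
    h * ∑ m ∈ Finset.range n, L2Norm (fun x => (u (m + 1) x - u m x) / h) ^ 2
      + energy q r (u n) ≤ energy q r (phi q r) := by
  induction n with
  | zero =>
    have e : u 0 =ᵐ[leb] phi q r :=
      ae_leb_of_forall fun x hx => hu.zero (Ioo_subset_Icc_self hx)
    rw [energy, energy, L2Norm_congr e, L2Norm_congr (weakDeriv_ae_eq (isPrimitive_phi q r) e),
      L2Norm_congr (isPrimitive_phi q r).weakDeriv_ae_eq]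
    simp
  | succ n ih =>
    have h1 := ih (Nat.le_of_succ_le hn)
    have h2 := hu.energy_step hh hn
    rw [Finset.sum_range_succ, mul_add]
    linarith

lemma energy_le (hh : 0 < h) (hu : IsDMS q r T h u) {n : ℕ} (hn : n ≤ ⌊T / h⌋₊) :
    energy q r (u n) ≤ energy q r (phi q r) := by
  have h1 := hu.sum_add_energy_le hh hn
  have h2 : 0 ≤ h * ∑ m ∈ Finset.range n, L2Norm (fun x => (u (m + 1) x - u m x) / h) ^ 2 :=
    mul_nonneg hh.le (Finset.sum_nonneg fun _ _ => sq_nonneg _)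
  linarith

lemma regularity (hu : IsDMS q r T h u) {m : ℕ} (hm : m < ⌊T / h⌋₊) :
    ∃ U₁ U₂, IsPrimitive (u (m + 1)) U₁ ∧ IsPrimitive U₁ U₂ ∧
      (∀ᵐ x ∂leb, viOp q r h (u m) (u (m + 1)) x (U₂ x) = 0) ∧
      ∀ᵐ x ∂leb, |U₂ x| ≤ |(u (m + 1) x - u m x) / h + beta q r * u (m + 1) x|
        + obstacleBound q r := by
  obtain ⟨g, hg⟩ := hu.isCompetitor hm.le
  obtain ⟨g', hg'⟩ := hu.isCompetitor hm
  exact minimizer_regularity hg.prim.continuousOn hg' (hu.minimal m hm)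

lemma isAESolution (hu : IsDMS q r T h u) {m : ℕ} (hm : m < ⌊T / h⌋₊) :
    IsAESolution q r h (u m) (u (m + 1)) := by
  obtain ⟨g', hg'⟩ := hu.isCompetitor hm
  obtain ⟨U₁, U₂, h1, h2, h3, -⟩ := hu.regularity hm
  exact isAESolution_of_isPrimitive hg' h1 h2 h3

lemma L2Norm_second_deriv_sq_le (hr : 0 < r) (hh : 0 < h) (hu : IsDMS q r T h u) {m : ℕ}
    (hm : m < ⌊T / h⌋₊) :
    L2Norm (weakDeriv (weakDeriv (u (m + 1)))) ^ 2
      ≤ 3 * L2Norm (fun x => (u (m + 1) x - u m x) / h) ^ 2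
        + 3 * (beta q r * energy q r (phi q r) + 2 * obstacleBound q r ^ 2) := by
  obtain ⟨g, hg⟩ := hu.isCompetitor hm.le
  obtain ⟨g', hg'⟩ := hu.isCompetitor hm
  obtain ⟨U₁, U₂, h1, h2, -, h4⟩ := hu.regularity hm
  set b := beta q r with hb
  set c := obstacleBound q r with hc
  have hb0 : 0 < b := beta_pos hr
  have hm1 : MemLp (fun x => (u (m + 1) x - u m x) / h) 2 leb :=
    memLp_difference_quotient hg'.prim.memLp_self hg.prim.memLp_self h
  have i1 := (integrable_sq_of_memLp hm1).const_mul 3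
  have i2 := (integrable_sq_of_memLp hg'.prim.memLp_self).const_mul (3 * b ^ 2)
  have i3 : Integrable (fun _ : ℝ => 3 * c ^ 2) leb := integrable_const _
  have hle : ∫ x, U₂ x ^ 2 ∂leb ≤ ∫ x, (3 * ((u (m + 1) x - u m x) / h) ^ 2
      + (3 * b ^ 2 * u (m + 1) x ^ 2 + 3 * c ^ 2)) ∂leb := by
    refine integral_mono_ae (integrable_sq_of_memLp h2.memLp) (i1.add (i2.add i3)) ?_
    filter_upwards [h4] with x hx
    set d := (u (m + 1) x - u m x) / h
    have s1 : |U₂ x| ≤ |d| + |b * u (m + 1) x| + c :=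
      hx.trans (by linarith [abs_add_le d (b * u (m + 1) x)])
    have s2 : U₂ x ^ 2 ≤ (|d| + |b * u (m + 1) x| + c) ^ 2 := by
      rw [← sq_abs (U₂ x)]
      exact pow_le_pow_left₀ (abs_nonneg _) s1 2
    have s3 : 3 * b ^ 2 * u (m + 1) x ^ 2 = 3 * |b * u (m + 1) x| ^ 2 := by rw [sq_abs]; ring
    rw [s3, ← sq_abs d]
    nlinarith [sq_nonneg (|d| - |b * u (m + 1) x|), sq_nonneg (|d| - c),
      sq_nonneg (|b * u (m + 1) x| - c)]
  have e : ∫ x, (3 * ((u (m + 1) x - u m x) / h) ^ 2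
      + (3 * b ^ 2 * u (m + 1) x ^ 2 + 3 * c ^ 2)) ∂leb
      = 3 * L2Norm (fun x => (u (m + 1) x - u m x) / h) ^ 2
        + (3 * b ^ 2 * L2Norm (u (m + 1)) ^ 2 + 2 * (3 * c ^ 2)) := by
    have e1 := integral_add i1 (i2.add i3)
    have e2 := integral_add i2 i3
    simp only [Pi.add_apply] at e1 e2
    rw [e1, e2, integral_const_mul, integral_const_mul, integral_const, leb_real_univ, smul_eq_mul,
      L2Norm_sq hm1, L2Norm_sq hg'.prim.memLp_self]
  have h5 := hu.energy_le hh hm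
  rw [energy, ← hb] at h5
  have h6 : b * L2Norm (u (m + 1)) ^ 2 ≤ energy q r (phi q r) := by
    linarith [sq_nonneg (L2Norm (weakDeriv (u (m + 1))))]
  have h7 := mul_le_mul_of_nonneg_left h6 hb0.le
  rw [L2Norm_congr (weakDeriv_weakDeriv_ae_eq h1 h2), L2Norm_sq h2.memLp]
  nlinarith

lemma H1Norm_le (hr : 0 < r) (hh : 0 < h) (hu : IsDMS q r T h u) {n : ℕ} (hn : n ≤ ⌊T / h⌋₊) :
    H1Norm (u n) ≤ √((1 / beta q r + 1) * energy q r (phi q r)) := by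
  have hb0 := beta_pos (q := q) hr
  have h1 := hu.energy_le hh hn
  rw [H1Norm]
  refine Real.sqrt_le_sqrt ?_
  have h2 : beta q r * L2Norm (u n) ^ 2 ≤ energy q r (phi q r) := by
    rw [energy] at h1; linarith [sq_nonneg (L2Norm (weakDeriv (u n)))]
  have h3 : L2Norm (weakDeriv (u n)) ^ 2 ≤ energy q r (phi q r) := by
    rw [energy] at h1; linarith [mul_nonneg hb0.le (sq_nonneg (L2Norm (u n)))]
  have h4 : L2Norm (u n) ^ 2 ≤ 1 / beta q r * energy q r (phi q r) := by
    rw [one_div, ← div_eq_inv_mul, le_div_iff₀ hb0]; linarith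
  linarith

lemma estimate (hr : 0 < r) (hT : 0 < T) (hh : 0 < h) (hu : IsDMS q r T h u) {n : ℕ}
    (hn : n ≤ ⌊T / h⌋₊) :
    h * ∑ m ∈ Finset.range ⌊T / h⌋₊, L2Norm (fun x => (u (m + 1) x - u m x) / h) ^ 2
        + H1Norm (u n)
        + h * ∑ m ∈ Finset.range ⌊T / h⌋₊, L2Norm (weakDeriv (weakDeriv (u (m + 1)))) ^ 2
      ≤ energy q r (phi q r) + √((1 / beta q r + 1) * energy q r (phi q r))
        + (3 * energy q r (phi q r)
          + T * (3 * (beta q r * energy q r (phi q r) + 2 * obstacleBound q r ^ 2))) := by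
  set D := 3 * (beta q r * energy q r (phi q r) + 2 * obstacleBound q r ^ 2) with hD
  have hD0 : 0 ≤ D := by
    have h1 := mul_nonneg (beta_pos (q := q) hr).le (energy_nonneg (q := q) hr (phi q r))
    have h2 := sq_nonneg (obstacleBound q r)
    linarith
  have h1 := hu.sum_add_energy_le hh le_rfl
  have h2 := energy_nonneg (q := q) hr (u ⌊T / h⌋₊)
  have h3 : ∑ m ∈ Finset.range ⌊T / h⌋₊, L2Norm (weakDeriv (weakDeriv (u (m + 1)))) ^ 2
      ≤ 3 * ∑ m ∈ Finset.range ⌊T / h⌋₊, L2Norm (fun x => (u (m + 1) x - u m x) / h) ^ 2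
        + ⌊T / h⌋₊ * D := by
    refine (Finset.sum_le_sum fun m hm =>
      hu.L2Norm_second_deriv_sq_le hr hh (Finset.mem_range.1 hm)).trans_eq ?_
    rw [Finset.sum_add_distrib, ← Finset.mul_sum, Finset.sum_const, Finset.card_range,
      nsmul_eq_mul]
  have h4 := mul_le_mul_of_nonneg_left h3 hh.le
  have h5 : h * ⌊T / h⌋₊ ≤ T := by
    have := Nat.floor_le (div_nonneg hT.le hh.le)
    rw [le_div_iff₀ hh] at this
    linarith
  have h6 := mul_le_mul_of_nonneg_right h5 hD0
  have h7 := hu.H1Norm_le hr hh hn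
  linarith

end IsDMS

end DMSBS

end

theorem theorem4p3 (q r T : ℝ) (hq : 0 < q) (hqr : q < r) (hT : 0 < T) :
    (∀ h : ℝ, 0 < h → ∃ u : ℕ → ℝ → ℝ, DMSBS.IsDMS q r T h u) ∧
    (∀ h : ℝ, 0 < h → ∀ u : ℕ → ℝ → ℝ, DMSBS.IsDMS q r T h u → ∀ m < ⌊T / h⌋₊,
      (DMSBS.IsAESolution q r h (u m) (u (m + 1)) ∧
        ∀ v : ℝ → ℝ, DMSBS.IsAESolution q r h (u m) v →
          Set.EqOn v (u (m + 1)) (Set.Icc (-1) 1)) ∧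
      (DMSBS.IsViscositySolution q r h (u m) (u (m + 1)) ∧
        ∀ v : ℝ → ℝ, DMSBS.IsViscositySolution q r h (u m) v →
          Set.EqOn v (u (m + 1)) (Set.Icc (-1) 1))) ∧
    ∃ C : ℝ, ∀ h : ℝ, 0 < h → ∀ u : ℕ → ℝ → ℝ, DMSBS.IsDMS q r T h u → ∀ n ≤ ⌊T / h⌋₊,
      h * ∑ m ∈ Finset.range ⌊T / h⌋₊,
          DMSBS.L2Norm (fun x => (u (m + 1) x - u m x) / h) ^ 2
        + DMSBS.H1Norm (u n)
        + h * ∑ m ∈ Finset.range ⌊T / h⌋₊,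
          DMSBS.L2Norm (DMSBS.weakDeriv (DMSBS.weakDeriv (u (m + 1)))) ^ 2 ≤ C := by
  have hr : 0 < r := hq.trans hqr
  refine ⟨fun h hh => DMSBS.exists_isDMS hr hh, fun h hh u hu m hm => ?_,
    _, fun h hh u hu n hn => hu.estimate hr hT hh hn⟩
  obtain ⟨g, hg⟩ := hu.isCompetitor hm.le
  have hw := hg.prim.continuousOn
  have hae := hu.isAESolution hm
  have hvisc := hae.isViscositySolution hw
  exact ⟨⟨hae, fun v hv => hvisc.eqOn hr hh hw (hv.isViscositySolution hw)⟩,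
    hvisc, fun v hv => hvisc.eqOn hr hh hw hv⟩
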